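/- Let $X$ be a finite set with $|X|\ge 3$. A split of $X$ is a bipartition $A|B=B|A$ of $X$ into two non-empty parts, and a split system on $X$ is a set $\mathcal S$ of splits of $X$ containing all trivial splits $\{x\}\,|\,X\setminus\{x\}$, $x\in X$. The Buneman graph $\mathcal B(\mathcal S)$ has as vertices all maps $\phi$ that assign to each $S\in\mathcal S$ one of its two parts in such a way that $\phi(S)\cap\phi(S')\neq\emptyset$ for all distinct $S,S'\in\mathcal S$; two vertices $\phi,\phi'$ are adjacent if $\phi(S)\ne\phi'(S)$ for exactly one $S\in\mathcal S$. Each $x\in X$ gives the vertex $\phi_x$ that maps every $S\in\mathcal S$ to the part of $S$ containing $x$. The graph $\mathcal B(\mathcal S)$ is a median graph, i.e. it is connected and any three vertices have a unique median (a vertex lying on shortest paths between each pair of them). The split system $\mathcal S$ is called injective if the medians of $\phi_x,\phi_y,\phi_z$ for distinct $3$-subsets $\{x,y,z\}$ of $X$ are distinct. The dimension $\dim(\mathcal S)$ is the largest $k$ such that $\mathcal B(\mathcal S)$ contains a $k$-dimensional hypercube. For $n\ge 3$ let $$\mathrm{ID}(n)=\min\{\dim(\mathcal S) : \mathcal S \text{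 is an injective split system on } \{1,\dots,n\}\}.$$ Theorem. For all integers $n\ge 4$ we have $\mathrm{ID}(n)\le\lfloor n/2\rfloor$. Moreover, $\mathrm{ID}(3)=1$, $\mathrm{ID}(4)=\mathrm{ID}(5)=2$, $\mathrm{ID}(6)=\mathrm{ID}(7)=\mathrm{ID}(8)=3$, and $\mathrm{ID}(n)\ge 3$ for all $n\ge 9$. -/

import Mathlib

/-- A split of the finite set `X`: a bipartition `A|B = B|A` of `X` into two nonempty parts,
represented by the unordered pair `{A, B}` of its parts. -/
def IsSplit {X : Type*} [Fintype X] [DecidableEq X] (S : Finset (Finset X)) : Prop :=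
  ∃ A B : Finset X, A.Nonempty ∧ B.Nonempty ∧ Disjoint A B ∧ A ∪ B = Finset.univ ∧ S = {A, B}

/-- `partOf S x` is the part `S(x)` of the split `S` that contains `x`
(formally, the union of all parts of `S` containing `x`; there is exactly one such part). -/
def partOf {X : Type*} [DecidableEq X] (S : Finset (Finset X)) (x : X) : Finset X :=
  (S.filter (fun A => x ∈ A)).biUnion id

theorem IsSplit.partOf_eq {X : Type*} [Fintype X] [DecidableEq X] {S : Finset (Finset X)}
    (hS : IsSplit S) {x : X} {C : Finset X} (hC : C ∈ S) (hx : x ∈ C) : partOf S x = C := by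
  obtain ⟨A, B, -, -, hd, -, rfl⟩ := hS
  have hAB : x ∈ A → x ∉ B := fun h => Finset.disjoint_left.mp hd h
  simp only [Finset.mem_insert, Finset.mem_singleton] at hC
  ext y
  simp only [partOf, Finset.mem_biUnion, Finset.mem_filter, Finset.mem_insert,
    Finset.mem_singleton, id]
  constructor
  · rintro ⟨D, ⟨hD, hxD⟩, hy⟩
    rcases hC with rfl | rfl <;> rcases hD with rfl | rfl <;> tauto
  · intro hy
    exact ⟨C, ⟨hC, hx⟩, hy⟩

theorem IsSplit.exists_mem {X : Type*} [Fintype X] [DecidableEq X] {S : Finset (Finset X)}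
    (hS : IsSplit S) (x : X) : ∃ C ∈ S, x ∈ C := by
  obtain ⟨A, B, -, -, -, hu, rfl⟩ := hS
  have hx : x ∈ A ∪ B := hu ▸ Finset.mem_univ x
  rcases Finset.mem_union.mp hx with h | h
  · exact ⟨A, by simp, h⟩
  · exact ⟨B, by simp, h⟩

theorem IsSplit.partOf_mem {X : Type*} [Fintype X] [DecidableEq X] {S : Finset (Finset X)}
    (hS : IsSplit S) (x : X) : partOf S x ∈ S := by
  obtain ⟨C, hC, hx⟩ := hS.exists_mem x
  rwa [hS.partOf_eq hC hx]

theorem IsSplit.mem_partOf {X : Type*} [Fintype X] [DecidableEq X] {S : Finset (Finset X)}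
    (hS : IsSplit S) (x : X) : x ∈ partOf S x := by
  obtain ⟨C, hC, hx⟩ := hS.exists_mem x
  rwa [hS.partOf_eq hC hx]

/-- A split system on `X`: a set of splits of `X` that contains all trivial splits
`{x} | X - {x}`. -/
structure SplitSystem (X : Type*) [Fintype X] [DecidableEq X] where
  splits : Finset (Finset (Finset X))
  isSplit : ∀ S ∈ splits, IsSplit S
  trivial_mem : ∀ x : X, ({{x}, {x}ᶜ} : Finset (Finset X)) ∈ splits

namespace SplitSystem

/-- The vertices of the Buneman graph: maps choosing a part of each split such that the parts
chosen for any two distinct splits intersect. -/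
def Vertex {X : Type*} [Fintype X] [DecidableEq X] (𝒮 : SplitSystem X) : Type _ :=
  {φ : {S // S ∈ 𝒮.splits} → Finset X //
    (∀ S, φ S ∈ S.1) ∧ ∀ S S', S ≠ S' → (φ S ∩ φ S').Nonempty}

/-- The Buneman graph of a split system: two vertices are adjacent if they differ on exactly one
split. -/
def bunemanGraph {X : Type*} [Fintype X] [DecidableEq X] (𝒮 : SplitSystem X) :
    SimpleGraph 𝒮.Vertex where
  Adj φ ψ := ∃! S, φ.1 S ≠ ψ.1 S
  symm := ⟨fun _ _ ⟨S, h, hu⟩ => ⟨S, h.symm, fun T hT => hu T hT.symm⟩⟩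
  loopless := ⟨fun _ ⟨_, h, _⟩ => h rfl⟩

/-- The vertex `φ_x` of the Buneman graph, `φ_x(S) = S(x)`. -/
def leaf {X : Type*} [Fintype X] [DecidableEq X] (𝒮 : SplitSystem X) (x : X) : 𝒮.Vertex :=
  ⟨fun S => partOf S.1 x, fun S => (𝒮.isSplit S.1 S.2).partOf_mem x, fun S S' _ =>
    ⟨x, Finset.mem_inter.mpr
      ⟨(𝒮.isSplit S.1 S.2).mem_partOf x, (𝒮.isSplit S'.1 S'.2).mem_partOf x⟩⟩⟩

end SplitSystem

/-- `m` is a median of the vertices `u, v, w` of `G`: it lies on shortest paths between each pair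
of them. (Used for connected graphs only.) -/
def IsMedian {V : Type*} (G : SimpleGraph V) (u v w m : V) : Prop :=
  G.dist u m + G.dist m v = G.dist u v ∧
  G.dist v m + G.dist m w = G.dist v w ∧
  G.dist u m + G.dist m w = G.dist u w

/-- The graph of the `k`-dimensional hypercube. -/
def cubeGraph (k : ℕ) : SimpleGraph (Fin k → Bool) where
  Adj a b := ∃! i, a i ≠ b i
  symm := ⟨fun _ _ ⟨i, h, hu⟩ => ⟨i, h.symm, fun j hj => hu j hj.symm⟩⟩
  loopless := ⟨fun _ ⟨_, h, _⟩ => h rfl⟩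

namespace SplitSystem

/-- `m` is a median, in the Buneman graph, of the three leaves given by the elements of the
3-subset `Y` of `X`. -/
def IsMedianOf {X : Type*} [Fintype X] [DecidableEq X] (𝒮 : SplitSystem X)
    (Y : Finset X) (m : 𝒮.Vertex) : Prop :=
  ∃ x y z : X, x ≠ y ∧ x ≠ z ∧ y ≠ z ∧ Y = {x, y, z} ∧
    IsMedian 𝒮.bunemanGraph (𝒮.leaf x) (𝒮.leaf y) (𝒮.leaf z) m

/-- A split system is injective if the map that sends each 3-subset `Y` of `X` to its unique
median in the Buneman graph is injective. -/
def IsInjective {X : Type*} [Fintype X] [DecidableEq X] (𝒮 : SplitSystem X) : Prop :=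
  ∃ med : {Y : Finset X // Y.card = 3} → 𝒮.Vertex,
    (∀ Y m, 𝒮.IsMedianOf Y.1 m ↔ m = med Y) ∧ Function.Injective med

/-- The dimension of a split system: the largest dimension of a hypercube contained in its
Buneman graph. (The Buneman graph is finite and has a vertex, so this is a maximum.) -/
noncomputable def dim {X : Type*} [Fintype X] [DecidableEq X] (𝒮 : SplitSystem X) : ℕ :=
  sSup {k : ℕ | (cubeGraph k).IsContained 𝒮.bunemanGraph}

end SplitSystem

/-- The injective dimension `ID(n)`, for `n ≥ 3`: the minimum dimension of an injective split
system on a set of `n` elements. -/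
noncomputable def injDim (n : ℕ) : ℕ :=
  sInf {d : ℕ | ∃ 𝒮 : SplitSystem (Fin n), 𝒮.IsInjective ∧ 𝒮.dim = d}

/-!
The dimension of a split system and its injectivity are both properties of the parts of its splits.

In the Buneman graph a vertex can always be moved towards another one by flipping a split whose
chosen part is minimal, so the graph distance is the Hamming distance (`dist_eq_hammingDist`).
Hence the median of three leaves chooses the majority part of every split, and a split system is
injective if and only if any two distinct 3-subsets have their majorities in different parts of
some split (`isInjective_iff`). Opposite edges of a 4-cycle flip the same split, so the edges at a
corner of a `k`-cube flip `k` pairwise incompatible splits; conversely such splits span a `k`-cube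
(`le_dim_iff`).

Lower bounds. Injectivity passes to subsets of `X`. Separating `{a, b, c}` from `{a, b, d}` splits
`a` from `b` and `c` from `d`, and on four points two such splits are incompatible, so the dimension
is at least 2 for `n ≥ 4`. Suppose that no three splits are pairwise incompatible. On five points the
nontrivial splits are the edges of a graph on these points (`PairIn`), which has neither a triangle
nor a vertex of degree 3. The separation of 3-subsets forces all degrees to be 2, so the graph is a
5-cycle (`IsQuintuple.exists_pentagon`). If a sixth point is added, a split of the six points
restricts to an edge of this cycle or to a trivial split. As the graphs on the other five 5-subsets
are 2-regular too, one gets a contradiction (`false_of_pentagon`), and the dimension is at least 3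
for `n ≥ 6`.

Upper bounds. The splits of `n` points on a circle into two arcs are injective. Each of them is given
by the two end points of an arc, and pairwise incompatible ones have distinct end points, so the
dimension is at most `n / 2` (`dim_circular_le`). For `n = 8` this gives only 4. There, a system of
13 nontrivial splits is injective and a union of three classes of pairwise compatible splits, so its
dimension is at most 3 (`isInjective_octet`, `dim_octet_le`).
-/

/-! ### Parts of splits, crossing and majority -/

section Majority

variable {X : Type*} [DecidableEq X] {A B Y : Finset X}

/-- `Maj A Y`: the majority of the 3-subset `Y` lies in `A`. -/
def Maj (A Y : Finset X) : Prop := 2 ≤ (Y ∩ A).card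

theorem inter_nonempty_of_maj (hY : Y.card = 3) (hA : Maj A Y) (hB : Maj B Y) :
    (A ∩ B).Nonempty := by
  by_contra h
  have hAB : A ∩ B = ∅ := Finset.not_nonempty_iff_eq_empty.1 h
  have h1 : Disjoint (Y ∩ A) (Y ∩ B) := by
    rw [Finset.disjoint_iff_inter_eq_empty, ← Finset.inter_inter_distrib_left, hAB,
      Finset.inter_empty]
  have h2 := Finset.card_union_of_disjoint h1
  have h3 : (Y ∩ A ∪ Y ∩ B).card ≤ Y.card :=
    Finset.card_le_card (Finset.union_subset Finset.inter_subset_left Finset.inter_subset_left)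
  unfold Maj at hA hB
  omega

theorem maj_triple {x y z : X} (hxy : x ≠ y) (hxz : x ≠ z) (hyz : y ≠ z) :
    Maj A {x, y, z} ↔ (x ∈ A ∧ y ∈ A) ∨ (y ∈ A ∧ z ∈ A) ∨ (x ∈ A ∧ z ∈ A) := by
  unfold Maj
  by_cases hx : x ∈ A <;> by_cases hy : y ∈ A <;> by_cases hz : z ∈ A <;>
    simp [hx, hy, hz, Finset.insert_inter_of_mem, Finset.insert_inter_of_notMem,
      Finset.singleton_inter_of_mem, Finset.singleton_inter_of_notMem, hxy, hxz, hyz]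

end Majority

section Splits

variable {X : Type*} [Fintype X] [DecidableEq X] {S T : Finset (Finset X)} {C D : Finset X}

theorem isSplit_pair_compl {A : Finset X} (h : A.Nonempty) (h' : Aᶜ.Nonempty) :
    IsSplit ({A, Aᶜ} : Finset (Finset X)) :=
  ⟨A, Aᶜ, h, h', disjoint_compl_right, Finset.union_compl A, rfl⟩

namespace IsSplit

theorem eq_pair_compl (hS : IsSplit S) (hC : C ∈ S) : S = {C, Cᶜ} := by
  obtain ⟨A, B, -, -, hd, hu, rfl⟩ := hS
  have hB : Aᶜ = B := (IsCompl.of_eq (disjoint_iff.1 hd) hu).compl_eq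
  rcases Finset.mem_insert.1 hC with rfl | h
  · rw [hB]
  · rw [Finset.mem_singleton.1 h, ← hB, compl_compl, Finset.pair_comm]

theorem eq_or_eq_compl (hS : IsSplit S) (hC : C ∈ S) (hD : D ∈ S) : D = C ∨ D = Cᶜ := by
  rw [hS.eq_pair_compl hC] at hD
  simpa using hD

theorem compl_mem (hS : IsSplit S) (hC : C ∈ S) : Cᶜ ∈ S := by
  rw [hS.eq_pair_compl hC]
  simp

theorem nonempty_of_mem (hS : IsSplit S) (hC : C ∈ S) : C.Nonempty := by
  obtain ⟨A, B, hA, hB, -, -, rfl⟩ := hS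
  rcases Finset.mem_insert.1 hC with rfl | h
  · exact hA
  · rw [Finset.mem_singleton.1 h]; exact hB

theorem eq_of_mem_of_mem (hS : IsSplit S) (hT : IsSplit T) (h : C ∈ S) (h' : C ∈ T) : S = T := by
  rw [hS.eq_pair_compl h, hT.eq_pair_compl h']

theorem partOf_eq_iff (hS : IsSplit S) (hC : C ∈ S) (x : X) : partOf S x = C ↔ x ∈ C :=
  ⟨fun h => h ▸ hS.mem_partOf x, fun h => hS.partOf_eq hC h⟩

end IsSplit

/-- Two subsets of `X` cross if the splits they define are incompatible: each of the two parts
of the one split meets each of the two parts of the other. -/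
def Cross (A B : Finset X) : Prop :=
  (A ∩ B).Nonempty ∧ (A ∩ Bᶜ).Nonempty ∧ (Aᶜ ∩ B).Nonempty ∧ (Aᶜ ∩ Bᶜ).Nonempty

instance : DecidableRel (Cross (X := X)) := fun A B => by unfold Cross; infer_instance

variable {A B Y : Finset X}

theorem Cross.symm (h : Cross A B) : Cross B A := by
  obtain ⟨h1, h2, h3, h4⟩ := h
  refine ⟨?_, ?_, ?_, ?_⟩ <;> rwa [Finset.inter_comm]

theorem Cross.compl_left (h : Cross A B) : Cross Aᶜ B := by
  obtain ⟨h1, h2, h3, h4⟩ := h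
  exact ⟨h3, h4, by rwa [compl_compl], by rwa [compl_compl]⟩

theorem not_cross_self (A : Finset X) : ¬ Cross A A := fun h => by simpa using h.2.1

theorem not_cross_compl_self (A : Finset X) : ¬ Cross A Aᶜ := fun h => by simpa using h.1

theorem not_cross_singleton (x : X) (A : Finset X) : ¬ Cross {x} A := by
  rintro ⟨⟨y, hy⟩, ⟨z, hz⟩, -⟩
  simp only [Finset.mem_inter, Finset.mem_singleton, Finset.mem_compl] at hy hz
  rw [hy.1] at hy
  rw [hz.1] at hz
  exact hz.2 hy.2

theorem Cross.of_mem {a b c d : X} (ha : a ∈ A ∧ a ∈ B) (hb : b ∈ A ∧ b ∉ B)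
    (hc : c ∉ A ∧ c ∈ B) (hd : d ∉ A ∧ d ∉ B) : Cross A B :=
  ⟨⟨a, by simpa using ha⟩, ⟨b, by simpa using hb⟩, ⟨c, by simpa using hc⟩,
    ⟨d, by simpa using hd⟩⟩

theorem maj_compl (hY : Y.card = 3) : Maj Aᶜ Y ↔ ¬ Maj A Y := by
  have h := Finset.card_inter_add_card_sdiff Y A
  have h' : Y ∩ Aᶜ = Y \ A := by ext; simp
  unfold Maj
  rw [h']
  omega

end Splits

/-! ### Distances and medians in the Buneman graph -/

/-- In a product of sets with the Hamming metric, equality holds in the triangle inequality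
exactly if the middle point agrees with one of the ends in every coordinate. -/
theorem hammingDist_add_eq_iff {ι : Type*} {β : ι → Type*} [Fintype ι] [∀ i, DecidableEq (β i)]
    (u m v : ∀ i, β i) :
    hammingDist u m + hammingDist m v = hammingDist u v ↔ ∀ i, m i = u i ∨ m i = v i := by
  simp only [hammingDist, Finset.card_filter, ← Finset.sum_add_distrib]
  have key := Finset.sum_eq_sum_iff_of_le (s := Finset.univ)
    (f := fun i => if u i ≠ v i then 1 else 0)
    (g := fun i => (if u i ≠ m i then 1 else 0) + (if m i ≠ v i then 1 else 0)) (by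
      intro i _
      split_ifs
      all_goals simp_all)
  rw [eq_comm, key]
  refine ⟨fun h i => ?_, fun h i _ => ?_⟩
  · have := h i (Finset.mem_univ i)
    by_contra! hc
    simp only [ne_eq, hc.1.symm, not_false_eq_true, hc.2, if_true] at this
    split_ifs at this
    omega
  · rcases h i with h | h <;> simp [h]

namespace SplitSystem

variable {X : Type*} [Fintype X] [DecidableEq X] (𝒮 : SplitSystem X)

/-- `A` is a part of some split of the system. -/
def IsSide (A : Finset X) : Prop := ({A, Aᶜ} : Finset (Finset X)) ∈ 𝒮.splits

variable {𝒮}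

theorem IsSide.compl {A : Finset X} (h : 𝒮.IsSide A) : 𝒮.IsSide Aᶜ := by
  unfold IsSide
  rwa [compl_compl, Finset.pair_comm]

theorem isSide_of_mem {S : Finset (Finset X)} (hS : S ∈ 𝒮.splits) {A : Finset X} (hA : A ∈ S) :
    𝒮.IsSide A := by
  unfold IsSide
  rwa [← (𝒮.isSplit S hS).eq_pair_compl hA]

namespace Vertex

theorem isSide (φ : 𝒮.Vertex) (S : {S // S ∈ 𝒮.splits}) : 𝒮.IsSide (φ.1 S) :=
  isSide_of_mem S.2 (φ.2.1 S)

theorem eq_or_eq_compl (φ ψ : 𝒮.Vertex) (S : {S // S ∈ 𝒮.splits}) :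
    ψ.1 S = φ.1 S ∨ ψ.1 S = (φ.1 S)ᶜ :=
  (𝒮.isSplit S.1 S.2).eq_or_eq_compl (φ.2.1 S) (ψ.2.1 S)

/-- Two vertices that both differ from a third at the split `S` agree at `S`. -/
theorem eq_of_ne_of_ne {φ ψ χ : 𝒮.Vertex} {S : {S // S ∈ 𝒮.splits}} (h : φ.1 S ≠ ψ.1 S)
    (h' : φ.1 S ≠ χ.1 S) : ψ.1 S = χ.1 S := by
  rw [(φ.eq_or_eq_compl ψ S).resolve_left h.symm, (φ.eq_or_eq_compl χ S).resolve_left h'.symm]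

end Vertex

theorem adj_iff_hammingDist {φ ψ : 𝒮.Vertex} :
    𝒮.bunemanGraph.Adj φ ψ ↔ hammingDist φ.1 ψ.1 = 1 := by
  rw [hammingDist, Finset.card_eq_one]
  simp only [bunemanGraph, Finset.eq_singleton_iff_unique_mem, Finset.mem_filter,
    Finset.mem_univ, true_and]
  rfl

/-- A vertex can be moved one step towards any other vertex: among the splits at which the two
differ, flip one whose chosen part is minimal. -/
theorem exists_adj_hammingDist {φ ψ : 𝒮.Vertex} (h : φ ≠ ψ) :
    ∃ χ, 𝒮.bunemanGraph.Adj φ χ ∧ hammingDist χ.1 ψ.1 + 1 = hammingDist φ.1 ψ.1 := by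
  have hne : (Finset.univ.filter fun S => φ.1 S ≠ ψ.1 S).Nonempty := by
    by_contra hc
    rw [Finset.not_nonempty_iff_eq_empty, Finset.filter_eq_empty_iff] at hc
    exact h (Subtype.ext (funext fun S => not_not.1 (hc (Finset.mem_univ S))))
  obtain ⟨S, hS, hmin⟩ := Finset.exists_min_image _ (fun S => (φ.1 S).card) hne
  simp only [Finset.mem_filter, Finset.mem_univ, true_and] at hS hmin
  have hψS : ψ.1 S = (φ.1 S)ᶜ := (φ.eq_or_eq_compl ψ S).resolve_left hS.symm
  have hmeet : ∀ T, T ≠ S → (ψ.1 S ∩ φ.1 T).Nonempty := by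
    intro T hT
    by_cases hφT : φ.1 T = ψ.1 T
    · rw [hφT]
      exact ψ.2.2 S T hT.symm
    · by_contra hc
      have hsub : φ.1 T ⊆ φ.1 S := by
        intro x hx
        by_contra hxS
        exact hc ⟨x, by simp [hψS, hx, hxS]⟩
      have heq := Finset.eq_of_subset_of_card_le hsub (hmin T hφT)
      exact hT (Subtype.ext ((𝒮.isSplit T.1 T.2).eq_of_mem_of_mem (𝒮.isSplit S.1 S.2)
        (φ.2.1 T) (heq ▸ φ.2.1 S)))
  let χ : 𝒮.Vertex := ⟨Function.update φ.1 S (ψ.1 S), by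
    intro T
    by_cases hT : T = S
    · subst hT; simpa using ψ.2.1 T
    · simpa [hT] using φ.2.1 T, by
    intro T T' hTT
    by_cases hT : T = S
    · subst hT
      rw [Function.update_self, Function.update_of_ne hTT.symm]
      exact hmeet T' hTT.symm
    · by_cases hT' : T' = S
      · subst hT'
        rw [Function.update_self, Function.update_of_ne hT, Finset.inter_comm]
        exact hmeet T hT
      · rw [Function.update_of_ne hT, Function.update_of_ne hT']
        exact φ.2.2 T T' hTT⟩
  have hχ : ∀ T, χ.1 T = if T = S then ψ.1 S else φ.1 T := by
    intro T
    simp only [χ, Function.update_apply]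
  have hadj : 𝒮.bunemanGraph.Adj φ χ := by
    refine ⟨S, ?_, fun T hT => ?_⟩
    · simpa [hχ] using hS
    · by_contra hc
      exact hT (by simp [hχ, hc])
  refine ⟨χ, hadj, ?_⟩
  have := (hammingDist_add_eq_iff φ.1 χ.1 ψ.1).2 fun T => by
    by_cases hT : T = S
    · right; rw [hχ, if_pos hT, hT]
    · left; rw [hχ, if_neg hT]
  rw [adj_iff_hammingDist.1 hadj] at this
  omega

theorem exists_walk_length_eq_hammingDist (φ ψ : 𝒮.Vertex) :
    ∃ p : 𝒮.bunemanGraph.Walk φ ψ, p.length = hammingDist φ.1 ψ.1 := by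
  induction hk : hammingDist φ.1 ψ.1 generalizing φ with
  | zero =>
    obtain rfl : φ = ψ := Subtype.ext (hammingDist_eq_zero.1 hk)
    exact ⟨.nil, rfl⟩
  | succ k ih =>
    have hne : φ ≠ ψ := by
      rintro rfl
      simp at hk
    obtain ⟨χ, hadj, hχ⟩ := exists_adj_hammingDist hne
    obtain ⟨p, hp⟩ := ih χ (by omega)
    exact ⟨.cons hadj p, by simp [hp]⟩

theorem hammingDist_le_length {φ ψ : 𝒮.Vertex} (p : 𝒮.bunemanGraph.Walk φ ψ) :
    hammingDist φ.1 ψ.1 ≤ p.length := by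
  induction p with
  | nil => simp
  | @cons u v w hadj p ih =>
    have := hammingDist_triangle u.1 v.1 w.1
    rw [adj_iff_hammingDist.1 hadj] at this
    rw [SimpleGraph.Walk.length_cons]
    omega

/-- The distance in the Buneman graph is the number of splits at which two vertices differ. -/
theorem dist_eq_hammingDist (φ ψ : 𝒮.Vertex) :
    𝒮.bunemanGraph.dist φ ψ = hammingDist φ.1 ψ.1 := by
  obtain ⟨p, hp⟩ := exists_walk_length_eq_hammingDist φ ψ
  obtain ⟨q, hq⟩ := p.reachable.exists_walk_length_eq_dist
  have h1 := SimpleGraph.dist_le p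
  have h2 := hammingDist_le_length q
  omega

/-- The medians of three leaves are the vertices that choose the majority part of every split. -/
theorem isMedianOf_iff {Y : Finset X} (hY : Y.card = 3) (m : 𝒮.Vertex) :
    𝒮.IsMedianOf Y m ↔ ∀ S, Maj (m.1 S) Y := by
  have key : ∀ x y z : X, x ≠ y → x ≠ z → y ≠ z →
      (IsMedian 𝒮.bunemanGraph (𝒮.leaf x) (𝒮.leaf y) (𝒮.leaf z) m ↔
        ∀ S, Maj (m.1 S) {x, y, z}) := by
    intro x y z hxy hxz hyz
    unfold IsMedian
    simp only [dist_eq_hammingDist, hammingDist_add_eq_iff, ← forall_and]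
    refine forall_congr' fun S => ?_
    have h := fun t => (𝒮.isSplit S.1 S.2).partOf_eq_iff (m.2.1 S) t
    rw [maj_triple hxy hxz hyz]
    simp only [leaf, eq_comm (a := m.1 S), h]
    tauto
  constructor
  · rintro ⟨x, y, z, hxy, hxz, hyz, rfl, hm⟩
    exact (key x y z hxy hxz hyz).1 hm
  · intro h
    obtain ⟨x, y, z, hxy, hxz, hyz, rfl⟩ := Finset.card_eq_three.1 hY
    exact ⟨x, y, z, hxy, hxz, hyz, rfl, (key x y z hxy hxz hyz).2 h⟩

/-- The majority parts of any two splits share a point of `Y`, so they form a vertex. -/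
theorem existsUnique_isMedianOf {Y : Finset X} (hY : Y.card = 3) :
    ∃! m : 𝒮.Vertex, 𝒮.IsMedianOf Y m := by
  have hex : ∀ S : {S // S ∈ 𝒮.splits}, ∃ A ∈ S.1, Maj A Y := by
    intro S
    obtain ⟨y, -⟩ : Y.Nonempty := Finset.card_pos.1 (by omega)
    obtain ⟨A, hA, -⟩ := (𝒮.isSplit S.1 S.2).exists_mem y
    by_cases h : Maj A Y
    · exact ⟨A, hA, h⟩
    · exact ⟨Aᶜ, (𝒮.isSplit S.1 S.2).compl_mem hA, (maj_compl hY).2 h⟩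
  choose φ hφ hmaj using hex
  refine ⟨⟨φ, hφ, fun S S' _ => inter_nonempty_of_maj hY (hmaj S) (hmaj S')⟩,
    (isMedianOf_iff hY _).2 hmaj, fun m hm => Subtype.ext (funext fun S => ?_)⟩
  replace hm := (isMedianOf_iff hY _).1 hm
  rcases (𝒮.isSplit S.1 S.2).eq_or_eq_compl (hφ S) (m.2.1 S) with h | h
  · exact h
  · exact absurd (hmaj S) ((maj_compl hY).1 (h ▸ hm S))

/-- Injectivity in terms of parts: for any two 3-subsets some split has their majorities in
different parts. -/
theorem isInjective_iff : 𝒮.IsInjective ↔ ∀ Y Z : Finset X, Y.card = 3 → Z.card = 3 → Y ≠ Z →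
    ∃ A, 𝒮.IsSide A ∧ Maj A Y ∧ ¬ Maj A Z := by
  constructor
  · rintro ⟨med, hmed, hinj⟩ Y Z hY hZ hne
    have hYm := (isMedianOf_iff hY _).1 ((hmed ⟨Y, hY⟩ _).2 rfl)
    have hZm := (isMedianOf_iff hZ _).1 ((hmed ⟨Z, hZ⟩ _).2 rfl)
    have hm : med ⟨Y, hY⟩ ≠ med ⟨Z, hZ⟩ := fun h => hne (congrArg Subtype.val (hinj h))
    obtain ⟨S, hS⟩ : ∃ S, (med ⟨Z, hZ⟩).1 S ≠ (med ⟨Y, hY⟩).1 S := by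
      by_contra! hc
      exact hm (Subtype.ext (funext fun S => (hc S).symm))
    have hc := ((med ⟨Y, hY⟩).eq_or_eq_compl (med ⟨Z, hZ⟩) S).resolve_left hS
    exact ⟨_, (med ⟨Y, hY⟩).isSide S, hYm S, (maj_compl hZ).1 (hc ▸ hZm S)⟩
  · intro h
    choose med hmed huniq using fun Y : {Y : Finset X // Y.card = 3} =>
      existsUnique_isMedianOf (𝒮 := 𝒮) Y.2
    refine ⟨med, fun Y m => ⟨huniq Y m, fun h => h ▸ hmed Y⟩, fun Y Z hYZ => ?_⟩
    by_contra hne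
    obtain ⟨A, hA, hAY, hAZ⟩ := h Y.1 Z.1 Y.2 Z.2 fun h => hne (Subtype.ext h)
    have hYm := (isMedianOf_iff Y.2 _).1 (hmed Y) ⟨_, hA⟩
    have hZm := (isMedianOf_iff Z.2 _).1 (hmed Z) ⟨_, hA⟩
    rw [← hYZ] at hZm
    rcases (𝒮.isSplit _ hA).eq_or_eq_compl (Finset.mem_insert_self A _) ((med Y).2.1 ⟨_, hA⟩) with h | h
    · rw [h] at hZm
      exact hAZ hZm
    · rw [h, maj_compl Y.2] at hYm
      exact hYm hAY

end SplitSystem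

/-! ### Cubes and pairwise incompatible splits -/

theorem cubeGraph_adj_update {k : ℕ} (a : Fin k → Bool) (i : Fin k) (h : a i = false) :
    (cubeGraph k).Adj a (Function.update a i true) := by
  refine ⟨i, by simp [h], fun j hj => ?_⟩
  by_contra hne
  exact hj (by simp [hne])

namespace SplitSystem

variable {X : Type*} [Fintype X] [DecidableEq X] {𝒮 : SplitSystem X}

theorem IsSide.isSplit {A : Finset X} (h : 𝒮.IsSide A) :
    IsSplit ({A, Aᶜ} : Finset (Finset X)) := 𝒮.isSplit _ h

theorem IsSide.nonempty {A : Finset X} (h : 𝒮.IsSide A) : A.Nonempty :=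
  h.isSplit.nonempty_of_mem (Finset.mem_insert_self _ _)

theorem IsSide.ne_compl {A : Finset X} (h : 𝒮.IsSide A) : A ≠ Aᶜ := by
  obtain ⟨x, hx⟩ := h.nonempty
  intro heq
  rw [heq, Finset.mem_compl] at hx
  have hx' := hx
  rw [heq, Finset.mem_compl] at hx'
  exact hx' hx

/-- The edges at a corner of a hypercube in the Buneman graph flip pairwise incompatible splits,
since opposite edges of a 4-cycle flip the same split. -/
theorem exists_cross_of_isContained {k : ℕ} (h : (cubeGraph k).IsContained 𝒮.bunemanGraph) :
    ∃ A : Fin k → Finset X, (∀ i, 𝒮.IsSide (A i)) ∧ ∀ i j, i ≠ j → Cross (A i) (A j) := by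
  obtain ⟨f⟩ := h
  let o : Fin k → Bool := fun _ => false
  let e : Fin k → Fin k → Bool := fun i => Function.update o i true
  have hoe : ∀ i, 𝒮.bunemanGraph.Adj (f o) (f (e i)) := fun i =>
    f.toHom.map_adj (cubeGraph_adj_update o i rfl)
  choose s hs huniq using hoe
  have hsame : ∀ i T, T ≠ s i → (f (e i)).1 T = (f o).1 T := fun i T hT => by
    by_contra hc
    exact hT (huniq i T fun h => hc h.symm)
  have hinj : ∀ i j, i ≠ j → s i ≠ s j := by
    intro i j hij hsij
    have : f (e i) = f (e j) := by
      refine Subtype.ext (funext fun T => ?_)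
      by_cases hT : T = s i
      · subst hT
        exact Vertex.eq_of_ne_of_ne (hs i) (hsij ▸ hs j)
      · rw [hsame i T hT, hsame j T (hsij ▸ hT)]
    have := congrFun (f.injective this) i
    simp [e, o, hij] at this
  -- the corner opposite to `o` in the square spanned by the directions `i` and `j`
  let d : Fin k → Fin k → Fin k → Bool := fun i j => Function.update (e i) j true
  have hdcomm : ∀ i j, i ≠ j → d i j = d j i := fun i j hij =>
    Function.update_comm hij _ _ _
  have hd : ∀ i j, i ≠ j → (f (d i j)).1 (s i) ≠ (f o).1 (s i) := by
    intro i j hij hc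
    have hadj : 𝒮.bunemanGraph.Adj (f (e i)) (f (d i j)) :=
      f.toHom.map_adj (cubeGraph_adj_update (e i) j (by simp [e, o, hij.symm]))
    obtain ⟨T, hT, hTu⟩ := hadj
    have hTs : s i = T := hTu _ fun h => hs i (by rw [← hc]; exact h.symm)
    have : f (d i j) = f o := by
      refine Subtype.ext (funext fun U => ?_)
      by_cases hU : U = s i
      · rw [hU]; exact hc
      · rw [← hsame i U hU]
        by_contra hne
        exact hU ((hTu U fun h => hne h.symm).trans hTs.symm)
    have := congrFun (f.injective this) i
    simp [d, e, o, hij] at this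
  have hflip : ∀ {φ : 𝒮.Vertex} {S}, φ.1 S ≠ (f o).1 S → φ.1 S = ((f o).1 S)ᶜ := fun {φ S} h =>
    ((f o).eq_or_eq_compl φ S).resolve_left h
  refine ⟨fun i => (f o).1 (s i), fun i => (f o).isSide _, fun i j hij => ⟨?_, ?_, ?_, ?_⟩⟩
  · exact (f o).2.2 _ _ (hinj i j hij)
  · beta_reduce
    rw [← hflip (hs j).symm, ← hsame j _ (hinj i j hij)]
    exact (f (e j)).2.2 _ _ (hinj i j hij)
  · beta_reduce
    rw [← hflip (hs i).symm, ← hsame i _ (hinj j i hij.symm)]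
    exact (f (e i)).2.2 _ _ (hinj i j hij)
  · beta_reduce
    rw [← hflip (hd i j hij), ← hflip (hdcomm i j hij ▸ hd j i hij.symm)]
    exact (f (d i j)).2.2 _ _ (hinj i j hij)

/-- Pairwise incompatible splits span a hypercube: their parts can be chosen freely, while every
other split gets a part that meets all parts of the given splits. -/
theorem isContained_of_cross [Nonempty X] {k : ℕ} {A : Fin k → Finset X}
    (hA : ∀ i, 𝒮.IsSide (A i)) (hcross : ∀ i j, i ≠ j → Cross (A i) (A j)) :
    (cubeGraph k).IsContained 𝒮.bunemanGraph := by
  obtain ⟨x⟩ := ‹Nonempty X›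
  let s : Fin k → {S // S ∈ 𝒮.splits} := fun i => ⟨{A i, (A i)ᶜ}, hA i⟩
  let c : (Fin k → Bool) → Fin k → Finset X := fun ε i => if ε i then A i else (A i)ᶜ
  have hc : ∀ ε i, c ε i = A i ∨ c ε i = (A i)ᶜ := fun ε i => by
    simp only [c]; split_ifs <;> simp
  have hcs : ∀ ε i, c ε i ∈ (s i).1 := fun ε i => by simpa [s] using hc ε i
  have hcc : ∀ ε i B j, (B = A j ∨ B = (A j)ᶜ) → i ≠ j → (B ∩ c ε i).Nonempty := by
    intro ε i B j hB hij
    obtain ⟨h1, h2, h3, h4⟩ := hcross j i hij.symm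
    rcases hB with rfl | rfl <;> rcases hc ε i with h | h <;> rw [h] <;> assumption
  have hs : Function.Injective s := by
    intro i j hij
    by_contra hne
    have hmem : A j ∈ (s i).1 := by rw [hij]; simp [s]
    have hx := hcross i j hne
    rcases Finset.mem_insert.1 hmem with h | h
    · exact not_cross_self _ (h ▸ hx)
    · exact not_cross_compl_self _ (Finset.mem_singleton.1 h ▸ hx)
  have hg : ∀ S : {S // S ∈ 𝒮.splits}, ∃ C, C ∈ S.1 ∧ ((∀ i, s i ≠ S) →
      (∀ B i, (B = A i ∨ B = (A i)ᶜ) → (C ∩ B).Nonempty) ∧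
        (x ∈ C ∨ ∃ B i, (B = A i ∨ B = (A i)ᶜ) ∧ B ⊆ C)) := by
    intro S
    have hS := 𝒮.isSplit S.1 S.2
    by_cases hall : ∀ B i, (B = A i ∨ B = (A i)ᶜ) → (partOf S.1 x ∩ B).Nonempty
    · exact ⟨_, hS.partOf_mem x, fun _ => ⟨hall, Or.inl (hS.mem_partOf x)⟩⟩
    · push Not at hall
      obtain ⟨D, i, hD, hdisj⟩ := hall
      have hsub : D ⊆ (partOf S.1 x)ᶜ := fun y hy => by
        rw [Finset.mem_compl]
        intro hy'
        exact Finset.notMem_empty y (hdisj ▸ Finset.mem_inter.2 ⟨hy', hy⟩)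
      refine ⟨_, hS.compl_mem (hS.partOf_mem x),
        fun hne => ⟨fun B j hB => ?_, Or.inr ⟨D, i, hD, hsub⟩⟩⟩
      by_cases hij : i = j
      · subst hij
        have hDs : 𝒮.IsSide D := by
          rcases hD with rfl | rfl
          · exact hA i
          · exact (hA i).compl
        have hBD : B = D ∨ B = Dᶜ := by
          rcases hB with rfl | rfl <;> rcases hD with rfl | rfl <;> simp
        rcases hBD with rfl | rfl
        · rw [Finset.inter_eq_right.2 hsub]
          exact hDs.nonempty
        · by_contra hcon
          have hsub' : (partOf S.1 x)ᶜ ⊆ D := fun y hy => by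
            by_contra hyD
            exact hcon ⟨y, by simpa using ⟨Finset.mem_compl.1 hy, hyD⟩⟩
          have hDS : D ∈ S.1 := by
            rw [hsub.antisymm hsub']
            exact hS.compl_mem (hS.partOf_mem x)
          refine hne i (Subtype.ext ((𝒮.isSplit _ (s i).2).eq_of_mem_of_mem hS ?_ hDS))
          simpa [s] using hD
      · obtain ⟨y, hy⟩ : (D ∩ B).Nonempty := by
          obtain ⟨h1, h2, h3, h4⟩ := hcross i j hij
          rcases hB with rfl | rfl <;> rcases hD with rfl | rfl <;> assumption
        rw [Finset.mem_inter] at hy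
        exact ⟨y, Finset.mem_inter.2 ⟨hsub hy.1, hy.2⟩⟩
  choose g hgmem hg using hg
  let φ : (Fin k → Bool) → {S // S ∈ 𝒮.splits} → Finset X := fun ε => Function.extend s (c ε) g
  have hφs : ∀ ε i, φ ε (s i) = c ε i := fun ε i => hs.extend_apply _ _ _
  have hφg : ∀ ε S, (∀ i, s i ≠ S) → φ ε S = g S := fun ε S h =>
    Function.extend_apply' _ _ _ fun ⟨i, hi⟩ => h i hi
  have hmix : ∀ ε i S, (∀ j, s j ≠ S) → (g S ∩ c ε i).Nonempty := fun ε i S h =>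
    (hg S h).1 _ i (hc ε i)
  let v : (Fin k → Bool) → 𝒮.Vertex := fun ε => ⟨φ ε, by
    intro S
    by_cases h : ∃ i, s i = S
    · obtain ⟨i, rfl⟩ := h
      rw [hφs]; exact hcs ε i
    · rw [hφg ε S (not_exists.1 h)]
      exact hgmem S, by
    intro S T hST
    by_cases h : ∃ i, s i = S <;> by_cases h' : ∃ i, s i = T
    · obtain ⟨i, rfl⟩ := h
      obtain ⟨j, rfl⟩ := h'
      rw [hφs, hφs]
      exact hcc ε j _ i (hc ε i) fun hij => hST (by rw [hij])
    · obtain ⟨i, rfl⟩ := h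
      rw [hφs, hφg ε T (not_exists.1 h'), Finset.inter_comm]
      exact hmix ε i T (not_exists.1 h')
    · obtain ⟨i, rfl⟩ := h'
      rw [hφs, hφg ε S (not_exists.1 h)]
      exact hmix ε i S (not_exists.1 h)
    · rw [hφg ε S (not_exists.1 h), hφg ε T (not_exists.1 h')]
      obtain ⟨hmS, hS⟩ := hg S (not_exists.1 h)
      obtain ⟨hmT, hT⟩ := hg T (not_exists.1 h')
      rcases hS with hS | ⟨B, i, hB, hBS⟩
      · rcases hT with hT | ⟨B, i, hB, hBT⟩
        · exact ⟨x, Finset.mem_inter.2 ⟨hS, hT⟩⟩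
        · exact (hmS B i hB).mono (Finset.inter_subset_inter_left hBT)
      · rw [Finset.inter_comm]
        exact (hmT B i hB).mono (Finset.inter_subset_inter_left hBS)⟩
  have hcne : ∀ ε δ i, ε i ≠ δ i → c ε i ≠ c δ i := by
    intro ε δ i h
    have := (hA i).ne_compl
    simp only [c]
    cases hε : ε i <;> cases hδ : δ i
    · exact absurd (hε.trans hδ.symm) h
    · simp
    · simp
    · exact absurd (hε.trans hδ.symm) h
  refine ⟨⟨⟨v, @fun ε δ => ?_⟩, fun ε δ hεδ => funext fun i => ?_⟩⟩
  · rintro ⟨i, hi, hu⟩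
    refine ⟨s i, ?_, fun S hS => ?_⟩
    · simp only [v, hφs]
      exact hcne ε δ i hi
    · by_cases h : ∃ j, s j = S
      · obtain ⟨j, rfl⟩ := h
        simp only [v, hφs, c] at hS
        rw [hu j fun h => hS (by rw [h])]
      · simp only [v, hφg _ S (not_exists.1 h)] at hS
        exact absurd rfl hS
  · by_contra hne
    have : φ ε (s i) = φ δ (s i) := congrFun (congrArg Subtype.val hεδ) (s i)
    rw [hφs, hφs] at this
    exact hcne ε δ i hne this

theorem bddAbove_isContained (𝒮 : SplitSystem X) :
    BddAbove {k : ℕ | (cubeGraph k).IsContained 𝒮.bunemanGraph} := by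
  refine ⟨𝒮.splits.card, fun k hk => ?_⟩
  obtain ⟨A, hA, hcross⟩ := exists_cross_of_isContained hk
  have := Finset.card_le_card_of_injOn (s := (Finset.univ : Finset (Fin k))) (t := 𝒮.splits)
    (fun i => {A i, (A i)ᶜ}) (fun i _ => hA i) (fun i _ j _ hij => by
      by_contra hne
      have hmem : A j ∈ ({A i, (A i)ᶜ} : Finset (Finset X)) := by
        simp only at hij
        rw [hij]; simp
      have hx := hcross i j hne
      rcases Finset.mem_insert.1 hmem with h | h
      · exact not_cross_self _ (h ▸ hx)
      · exact not_cross_compl_self _ (Finset.mem_singleton.1 h ▸ hx))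
  simpa using this

/-- The dimension is at least `k` if and only if there are `k` pairwise incompatible splits. -/
theorem le_dim_iff [Nonempty X] {k : ℕ} : k ≤ 𝒮.dim ↔
    ∃ A : Fin k → Finset X, (∀ i, 𝒮.IsSide (A i)) ∧ ∀ i j, i ≠ j → Cross (A i) (A j) := by
  constructor
  · intro h
    have hne : {k : ℕ | (cubeGraph k).IsContained 𝒮.bunemanGraph}.Nonempty :=
      ⟨0, isContained_of_cross (A := Fin.elim0) (fun i => i.elim0) (fun i => i.elim0)⟩
    obtain ⟨A, hA, hcross⟩ := exists_cross_of_isContained (Nat.sSup_mem hne 𝒮.bddAbove_isContained)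
    exact ⟨fun i => A (Fin.castLE h i), fun i => hA _, fun i j hij =>
      hcross _ _ fun h' => hij (Fin.castLE_injective h h')⟩
  · rintro ⟨A, hA, hcross⟩
    exact le_csSup 𝒮.bddAbove_isContained (isContained_of_cross hA hcross)

end SplitSystem

/-! ### Separating families on four and five points -/

section Quintuples

variable {X : Type*} {P : Finset X → Prop} {s : Finset X} {a b c d e : X}

/-- `a` and `b` are adjacent in the graph of the restriction of the family to `s` if some member
of the family meets `s` exactly in `{a, b}`. -/
def PairIn (P : Finset X → Prop) (s : Finset X) (a b : X) : Prop :=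
  ∃ A, P A ∧ ∀ x ∈ s, (x ∈ A ↔ x = a ∨ x = b)

theorem PairIn.symm (h : PairIn P s a b) : PairIn P s b a := by
  obtain ⟨A, hA, h⟩ := h
  exact ⟨A, hA, fun x hx => (h x hx).trans or_comm⟩

/-- The set `s` consists of the five distinct points `a, b, c, d, e`. -/
structure IsQuintuple (s : Finset X) (a b c d e : X) : Prop where
  nodup : [a, b, c, d, e].Nodup
  mem_iff : ∀ x, x ∈ s ↔ x = a ∨ x = b ∨ x = c ∨ x = d ∨ x = e

namespace IsQuintuple

theorem of_perm {a' b' c' d' e' : X} (h : IsQuintuple s a b c d e)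
    (hp : [a', b', c', d', e'].Perm [a, b, c, d, e]) : IsQuintuple s a' b' c' d' e' :=
  ⟨hp.nodup_iff.2 h.nodup, fun x => by
    have h1 := h.mem_iff x
    have h2 := hp.mem_iff (a := x)
    simp only [List.mem_cons, List.not_mem_nil, or_false] at h2
    rw [h1, h2]⟩

theorem ne (h : IsQuintuple s a b c d e) : a ≠ b ∧ a ≠ c ∧ a ≠ d ∧ a ≠ e ∧ b ≠ c ∧ b ≠ d ∧ b ≠ e ∧
    c ≠ d ∧ c ≠ e ∧ d ≠ e := by
  have := h.nodup
  simp only [List.nodup_cons, List.mem_cons, List.not_mem_nil, or_false, not_or] at this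
  tauto

theorem forall_mem (h : IsQuintuple s a b c d e) {p : X → Prop} :
    (∀ x ∈ s, p x) ↔ p a ∧ p b ∧ p c ∧ p d ∧ p e := by
  simp only [h.mem_iff]
  constructor
  · intro h
    exact ⟨h _ (by simp), h _ (by simp), h _ (by simp), h _ (by simp), h _ (by simp)⟩
  · rintro ⟨ha, hb, hc, hd, he⟩ x (rfl | rfl | rfl | rfl | rfl) <;> assumption

theorem pairIn_iff (h : IsQuintuple s a b c d e) :
    PairIn P s a b ↔ ∃ A, P A ∧ a ∈ A ∧ b ∈ A ∧ c ∉ A ∧ d ∉ A ∧ e ∉ A := by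
  unfold PairIn
  obtain ⟨h1, h2, h3, h4, h5, h6, h7, h8, h9, h10⟩ := h.ne
  simp [h.forall_mem, h2.symm, h3.symm, h4.symm, h5.symm, h6.symm, h7.symm]

theorem exists_of_card [DecidableEq X] (hs : s.card = 5) : ∃ a b c d e, IsQuintuple s a b c d e := by
  obtain ⟨a, t, ha, rfl, ht⟩ := Finset.card_eq_succ.1 hs
  obtain ⟨b, u, hb, rfl, hu⟩ := Finset.card_eq_succ.1 ht
  obtain ⟨c, d, e, hcd, hce, hde, rfl⟩ := Finset.card_eq_three.1 hu
  refine ⟨a, b, c, d, e, ?_, by simp⟩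
  simp only [Finset.mem_insert, Finset.mem_singleton] at ha hb
  simp only [List.nodup_cons, List.mem_cons, List.not_mem_nil, or_false, not_false_eq_true,
    List.nodup_nil, and_true]
  tauto

end IsQuintuple

end Quintuples

section Separating

variable {X : Type*} [Fintype X] [DecidableEq X] {P : Finset X → Prop}

/-- A family of subsets that is closed under complements and, for any two distinct 3-subsets,
contains a set with the majority of the one but not of the other. -/
structure IsSeparating (P : Finset X → Prop) : Prop where
  compl : ∀ A, P A → P Aᶜ
  sep : ∀ Y Z : Finset X, Y.card = 3 → Z.card = 3 → Y ≠ Z → ∃ A, P A ∧ Maj A Y ∧ ¬ Maj A Z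

/-- A family of subsets without three pairwise crossing members: for the parts of the splits of a
split system this says that the dimension is at most 2. -/
def NoThreeCross (P : Finset X → Prop) : Prop :=
  ∀ A B C, P A → P B → P C → Cross A B → Cross A C → Cross B C → False

/-- The preimages under `f` of the members of the family `P`. -/
def preimageFamily {Y : Type*} (f : Y → X) (P : Finset X → Prop) (B : Finset Y) : Prop :=
  ∃ A, P A ∧ ∀ y, y ∈ B ↔ f y ∈ A

theorem Cross.of_preimage {Y : Type*} [Fintype Y] [DecidableEq Y] {f : Y → X}
    {A A' : Finset X} {B B' : Finset Y} (hA : ∀ y, y ∈ B ↔ f y ∈ A)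
    (hA' : ∀ y, y ∈ B' ↔ f y ∈ A') (h : Cross B B') : Cross A A' := by
  obtain ⟨⟨a, ha⟩, ⟨b, hb⟩, ⟨c, hc⟩, ⟨d, hd⟩⟩ := h
  simp only [Finset.mem_inter, Finset.mem_compl, hA, hA'] at ha hb hc hd
  exact Cross.of_mem ha hb hc hd

theorem NoThreeCross.comap {Y : Type*} [Fintype Y] [DecidableEq Y] (hP : NoThreeCross P)
    (f : Y → X) : NoThreeCross (preimageFamily f P) := by
  rintro A B C ⟨A', hA', hA⟩ ⟨B', hB', hB⟩ ⟨C', hC', hC⟩ hAB hAC hBC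
  exact hP A' B' C' hA' hB' hC' (.of_preimage hA hB hAB) (.of_preimage hA hC hAC)
    (.of_preimage hB hC hBC)

theorem IsSeparating.comap {Y : Type*} [Fintype Y] [DecidableEq Y] (hP : IsSeparating P)
    (f : Y ↪ X) : IsSeparating (preimageFamily f P) := by
  constructor
  · rintro B ⟨A, hA, hB⟩
    exact ⟨Aᶜ, hP.compl A hA, fun y => by rw [Finset.mem_compl, Finset.mem_compl, hB]⟩
  · intro U V hU hV hne
    obtain ⟨A, hA, hAU, hAV⟩ := hP.sep (U.map f) (V.map f) (by simpa) (by simpa)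
      fun h => hne (Finset.map_injective f h)
    refine ⟨Finset.univ.filter fun y => f y ∈ A, ⟨A, hA, by simp⟩, ?_⟩
    have key : ∀ W : Finset Y, Maj (Finset.univ.filter fun y => f y ∈ A) W ↔ Maj A (W.map f) := by
      intro W
      unfold Maj
      rw [← Finset.card_map f]
      have : (W ∩ Finset.univ.filter fun y => f y ∈ A).map f = W.map f ∩ A := by
        ext z
        simp only [Finset.mem_map, Finset.mem_inter, Finset.mem_filter, Finset.mem_univ,
          true_and]
        constructor
        · rintro ⟨y, ⟨hy, hyA⟩, rfl⟩
          exact ⟨⟨y, hy, rfl⟩, hyA⟩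
        · rintro ⟨⟨y, hy, rfl⟩, hyA⟩
          exact ⟨y, ⟨hy, hyA⟩, rfl⟩
      rw [this]
    rw [key, key]
    exact ⟨hAU, hAV⟩

/-- Separating `{a, b, c}` from `{a, b, d}` splits `a` from `b` and `c` from `d`. -/
theorem IsSeparating.quartet (hP : IsSeparating P) {a b c d : X} (hab : a ≠ b) (hac : a ≠ c)
    (had : a ≠ d) (hbc : b ≠ c) (hbd : b ≠ d) (hcd : c ≠ d) :
    ∃ A, P A ∧ a ∈ A ∧ b ∉ A ∧ (c ∈ A ↔ d ∉ A) := by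
  obtain ⟨A, hA, h1, h2⟩ := hP.sep {a, b, c} {a, b, d} (Finset.card_eq_three.2
    ⟨a, b, c, hab, hac, hbc, rfl⟩) (Finset.card_eq_three.2 ⟨a, b, d, hab, had, hbd, rfl⟩) (by
      intro h
      have : c ∈ ({a, b, d} : Finset X) := by rw [← h]; simp
      simp [hac.symm, hbc.symm, hcd] at this)
  rw [maj_triple hab hac hbc] at h1
  rw [maj_triple hab had hbd] at h2
  by_cases ha : a ∈ A
  · exact ⟨A, hA, ha, by tauto, by tauto⟩
  · refine ⟨Aᶜ, hP.compl A hA, ?_⟩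
    simp only [Finset.mem_compl]
    tauto

theorem IsSeparating.exists_cross (hP : IsSeparating P) (hX : 4 ≤ Fintype.card X) :
    ∃ A B, P A ∧ P B ∧ Cross A B := by
  obtain ⟨f⟩ := Function.Embedding.nonempty_of_card_le (α := Fin 4) (β := X) (by simpa)
  have hf : ∀ i j, i ≠ j → f i ≠ f j := fun i j h h' => h (f.injective h')
  have h01 := hf 0 1 (by decide)
  have h02 := hf 0 2 (by decide)
  have h03 := hf 0 3 (by decide)
  have h12 := hf 1 2 (by decide)
  have h13 := hf 1 3 (by decide)
  have h23 := hf 2 3 (by decide)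
  obtain ⟨A, hA, h0, h1, h2⟩ := hP.quartet h01 h02 h03 h12 h13 h23
  -- the second set separates the two points on the side of `f 0`, and the two others
  by_cases h : f 2 ∈ A
  · obtain ⟨B, hB, k0, k1, k2⟩ := hP.quartet h02 h01 h03 h12.symm h23 h13
    refine ⟨A, B, hA, hB, ?_⟩
    by_cases k : f 1 ∈ B
    · exact .of_mem ⟨h0, k0⟩ ⟨h, k1⟩ ⟨h1, k⟩ ⟨h2.1 h, k2.1 k⟩
    · exact .of_mem ⟨h0, k0⟩ ⟨h, k1⟩ ⟨h2.1 h, by tauto⟩ ⟨h1, k⟩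
  · obtain ⟨B, hB, k0, k1, k2⟩ := hP.quartet h03 h01 h02 h13.symm h23.symm h12
    have h3 : f 3 ∈ A := by tauto
    refine ⟨A, B, hA, hB, ?_⟩
    by_cases k : f 1 ∈ B
    · exact .of_mem ⟨h0, k0⟩ ⟨h3, k1⟩ ⟨h1, k⟩ ⟨h, k2.1 k⟩
    · exact .of_mem ⟨h0, k0⟩ ⟨h3, k1⟩ ⟨h, by tauto⟩ ⟨h1, k⟩

variable {s : Finset X} {a b c d e : X}

namespace IsQuintuple

/-- The graph has maximum degree 2, as pairs with a common point cross within five points. -/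
theorem not_star (h : IsQuintuple s a b c d e) (hP : NoThreeCross P) :
    ¬ (PairIn P s a b ∧ PairIn P s a c ∧ PairIn P s a d) := by
  rintro ⟨⟨A, hA, hA'⟩, ⟨B, hB, hB'⟩, ⟨C, hC, hC'⟩⟩
  rw [h.forall_mem] at hA' hB' hC'
  obtain ⟨h1, h2, h3, h4, h5, h6, h7, h8, h9, h10⟩ := h.ne
  simp only [true_or, or_true, h1.symm, h2.symm, h3.symm, h4.symm, h5, h6, h8, h7.symm, h5.symm,
    h6.symm, h8.symm, h9.symm, h10.symm, or_self, iff_true, iff_false] at hA' hB' hC'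
  obtain ⟨a1, a2, a3, a4, a5⟩ := hA'
  obtain ⟨b1, b2, b3, b4, b5⟩ := hB'
  obtain ⟨c1, c2, c3, c4, c5⟩ := hC'
  exact hP A B C hA hB hC (.of_mem ⟨a1, b1⟩ ⟨a2, b2⟩ ⟨a3, b3⟩ ⟨a5, b5⟩)
    (.of_mem ⟨a1, c1⟩ ⟨a2, c2⟩ ⟨a4, c4⟩ ⟨a5, c5⟩) (.of_mem ⟨b1, c1⟩ ⟨b3, c3⟩ ⟨b4, c4⟩ ⟨b5, c5⟩)

theorem not_triangle (h : IsQuintuple s a b c d e) (hP : NoThreeCross P) :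
    ¬ (PairIn P s a b ∧ PairIn P s a c ∧ PairIn P s b c) := by
  rintro ⟨⟨A, hA, hA'⟩, ⟨B, hB, hB'⟩, ⟨C, hC, hC'⟩⟩
  rw [h.forall_mem] at hA' hB' hC'
  obtain ⟨h1, h2, h3, h4, h5, h6, h7, h8, h9, h10⟩ := h.ne
  simp only [true_or, or_true, h1, h2, h1.symm, h2.symm, h3.symm, h4.symm, h5, h7.symm, h5.symm,
    h6.symm, h8.symm, h9.symm, or_self, iff_true, iff_false] at hA' hB' hC'
  obtain ⟨a1, a2, a3, a4, a5⟩ := hA'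
  obtain ⟨b1, b2, b3, b4, b5⟩ := hB'
  obtain ⟨c1, c2, c3, c4, c5⟩ := hC'
  exact hP A B C hA hB hC (.of_mem ⟨a1, b1⟩ ⟨a2, b2⟩ ⟨a3, b3⟩ ⟨a5, b5⟩)
    (.of_mem ⟨a2, c2⟩ ⟨a1, c1⟩ ⟨a3, c3⟩ ⟨a5, c5⟩) (.of_mem ⟨b3, c3⟩ ⟨b1, c1⟩ ⟨b2, c2⟩ ⟨b5, c5⟩)

/-- A member of the family that has `a, b` on one side and `c, d, e` on the other. -/
theorem pairIn_of_mem (h : IsQuintuple s a b c d e) (hP : IsSeparating P) {A : Finset X}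
    (hA : P A) (hab : a ∈ A ↔ b ∈ A) (hac : a ∈ A ↔ c ∉ A) (had : a ∈ A ↔ d ∉ A)
    (hae : a ∈ A ↔ e ∉ A) : PairIn P s a b := by
  rw [h.pairIn_iff]
  by_cases ha : a ∈ A
  · exact ⟨A, hA, by tauto⟩
  · refine ⟨Aᶜ, hP.compl A hA, ?_⟩
    simp only [Finset.mem_compl]
    tauto

/-- Separating `{a, b, c}` from `{a, b, d}` needs one of the pairs that split `a` from `b` and `c`
from `d`. -/
theorem pairIn_quartet (h : IsQuintuple s a b c d e) (hP : IsSeparating P) :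
    PairIn P s a c ∨ PairIn P s b d ∨ PairIn P s a d ∨ PairIn P s b c := by
  obtain ⟨h1, h2, h3, h4, h5, h6, h7, h8, h9, h10⟩ := h.ne
  obtain ⟨A, hA, ha, hb, hcd⟩ := hP.quartet h1 h2 h3 h5 h6 h8
  have hac : IsQuintuple s a c b d e := h.of_perm (by grind)
  have hbd : IsQuintuple s b d a c e := h.of_perm (by grind)
  have had : IsQuintuple s a d b c e := h.of_perm (by grind)
  have hbc : IsQuintuple s b c a d e := h.of_perm (by grind)
  by_cases hc : c ∈ A <;> by_cases he : e ∈ A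
  · exact .inr (.inl (hbd.pairIn_of_mem hP hA (by tauto) (by tauto) (by tauto) (by tauto)))
  · exact .inl (hac.pairIn_of_mem hP hA (by tauto) (by tauto) (by tauto) (by tauto))
  · exact .inr (.inr (.inr (hbc.pairIn_of_mem hP hA (by tauto) (by tauto) (by tauto) (by tauto))))
  · exact .inr (.inr (.inl (had.pairIn_of_mem hP hA (by tauto) (by tauto) (by tauto) (by tauto))))

/-- Separating `{a, b, c}` from `{a, d, e}` needs one of the pairs other than
`bd`, `be`, `cd`, `ce`. -/
theorem pairIn_quintet (h : IsQuintuple s a b c d e) (hP : IsSeparating P) :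
    PairIn P s a b ∨ PairIn P s a c ∨ PairIn P s a d ∨ PairIn P s a e ∨ PairIn P s b c ∨
      PairIn P s d e := by
  obtain ⟨h1, h2, h3, h4, h5, h6, h7, h8, h9, h10⟩ := h.ne
  obtain ⟨A, hA, k1, k2⟩ := hP.sep {a, b, c} {a, d, e} (Finset.card_eq_three.2
    ⟨a, b, c, h1, h2, h5, rfl⟩) (Finset.card_eq_three.2 ⟨a, d, e, h3, h4, h10, rfl⟩) (by
      intro h
      have : b ∈ ({a, d, e} : Finset X) := by rw [← h]; simp
      simp [h1.symm, h6, h7] at this)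
  rw [maj_triple h1 h2 h5] at k1
  rw [maj_triple h3 h4 h10] at k2
  have hac : IsQuintuple s a c b d e := h.of_perm (by grind)
  have had : IsQuintuple s a d b c e := h.of_perm (by grind)
  have hae : IsQuintuple s a e b c d := h.of_perm (by grind)
  have hbc : IsQuintuple s b c a d e := h.of_perm (by grind)
  have hde : IsQuintuple s d e a b c := h.of_perm (by grind)
  have m1 := h.pairIn_of_mem hP hA
  have m2 := hac.pairIn_of_mem hP hA
  have m3 := had.pairIn_of_mem hP hA
  have m4 := hae.pairIn_of_mem hP hA
  have m5 := hbc.pairIn_of_mem hP hA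
  have m6 := hde.pairIn_of_mem hP hA
  by_cases a ∈ A <;> by_cases b ∈ A <;> by_cases c ∈ A <;> by_cases d ∈ A <;> by_cases e ∈ A <;>
    simp_all

/-- Among any three other points of the 5-subset there is a neighbour of `a`. Otherwise the only
graph that meets the conditions for all 4-subsets is a 4-cycle that misses `a`, which does not
separate the two 3-subsets formed by `a` and a diagonal of that cycle. -/
theorem pairIn_or (h : IsQuintuple s a b c d e) (hP : IsSeparating P) (hP' : NoThreeCross P) :
    PairIn P s a b ∨ PairIn P s a c ∨ PairIn P s a d := by
  have perm : ∀ {x y z w v : X}, [x, y, z, w, v].Perm [a, b, c, d, e] → IsQuintuple s x y z w v :=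
    fun hp => h.of_perm hp
  have q1 := h.pairIn_quartet hP
  have q2 := (perm (x := a) (y := c) (z := b) (w := d) (v := e) (by grind)).pairIn_quartet hP
  have q3 := (perm (x := a) (y := d) (z := b) (w := c) (v := e) (by grind)).pairIn_quartet hP
  have q4 := (perm (x := b) (y := c) (z := a) (w := e) (v := d) (by grind)).pairIn_quartet hP
  have q5 := (perm (x := b) (y := d) (z := a) (w := e) (v := c) (by grind)).pairIn_quartet hP
  have q6 := (perm (x := c) (y := d) (z := a) (w := e) (v := b) (by grind)).pairIn_quartet hP
  have t := (perm (x := b) (y := c) (z := d) (w := a) (v := e) (by grind)).not_triangle hP'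
  have s1 := (perm (x := b) (y := c) (z := d) (w := e) (v := a) (by grind)).not_star hP'
  have s2 := (perm (x := c) (y := b) (z := d) (w := e) (v := a) (by grind)).not_star hP'
  have s3 := (perm (x := d) (y := b) (z := c) (w := e) (v := a) (by grind)).not_star hP'
  have s4 := (perm (x := e) (y := a) (z := b) (w := c) (v := d) (by grind)).not_star hP'
  have s5 := (perm (x := e) (y := a) (z := b) (w := d) (v := c) (by grind)).not_star hP'
  have s6 := (perm (x := e) (y := a) (z := c) (w := d) (v := b) (by grind)).not_star hP'
  have r1 := (perm (x := a) (y := b) (z := e) (w := c) (v := d) (by grind)).pairIn_quintet hP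
  have r2 := (perm (x := a) (y := c) (z := e) (w := b) (v := d) (by grind)).pairIn_quintet hP
  have r3 := (perm (x := a) (y := d) (z := e) (w := b) (v := c) (by grind)).pairIn_quintet hP
  have symm : ∀ x y, PairIn P s x y ↔ PairIn P s y x := fun x y => ⟨PairIn.symm, PairIn.symm⟩
  simp only [symm b a, symm c a, symm d a, symm e a, symm c b, symm d b, symm e b, symm d c,
    symm e c, symm e d] at *
  grind

/-- Every point has degree 2 and there are no triangles, so the graph is a 5-cycle. -/
theorem exists_pentagon (hs : s.card = 5) (hP : IsSeparating P) (hP' : NoThreeCross P) :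
    ∃ a b c d e, IsQuintuple s a b c d e ∧ PairIn P s a b ∧ PairIn P s b c ∧ PairIn P s c d ∧
      PairIn P s d e ∧ PairIn P s e a := by
  -- choose the labels so that `a` is adjacent to `b` and `e`, and `b` is adjacent to `c`
  obtain ⟨a, b, c, d, e, h, hab⟩ : ∃ a b c d e, IsQuintuple s a b c d e ∧ PairIn P s a b := by
    obtain ⟨a, b, c, d, e, h⟩ := exists_of_card hs
    rcases h.pairIn_or hP hP' with h1 | h1 | h1
    · exact ⟨a, b, c, d, e, h, h1⟩
    · exact ⟨a, c, b, d, e, h.of_perm (by grind), h1⟩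
    · exact ⟨a, d, b, c, e, h.of_perm (by grind), h1⟩
  obtain ⟨b, c, d, e, h, hab, hae⟩ : ∃ b c d e, IsQuintuple s a b c d e ∧ PairIn P s a b ∧
      PairIn P s a e := by
    have h' : IsQuintuple s a c d e b := h.of_perm (by grind)
    rcases h'.pairIn_or hP hP' with h1 | h1 | h1
    · exact ⟨b, d, e, c, h.of_perm (by grind), hab, h1⟩
    · exact ⟨b, c, e, d, h.of_perm (by grind), hab, h1⟩
    · exact ⟨b, c, d, e, h, hab, h1⟩
  obtain ⟨c, d, h, hbc⟩ : ∃ c d, IsQuintuple s a b c d e ∧ PairIn P s b c := by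
    have h' : IsQuintuple s b c d e a := h.of_perm (by grind)
    have ht : IsQuintuple s a b e c d := h.of_perm (by grind)
    rcases h'.pairIn_or hP hP' with h1 | h1 | h1
    · exact ⟨c, d, h, h1⟩
    · exact ⟨d, c, h.of_perm (by grind), h1⟩
    · exact absurd ⟨hab, hae, h1⟩ (ht.not_triangle hP')
  -- `a` and `b` have no further neighbours, so those of `d` are `c` and `e`
  have hda : ¬ PairIn P s d a := fun h1 =>
    (h.of_perm (by grind) : IsQuintuple s a b e d c).not_star hP' ⟨hab, hae, h1.symm⟩
  have hdb : ¬ PairIn P s d b := fun h1 =>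
    (h.of_perm (by grind) : IsQuintuple s b a c d e).not_star hP' ⟨hab.symm, hbc, h1.symm⟩
  have hdc := (h.of_perm (by grind) : IsQuintuple s d a b c e).pairIn_or hP hP'
  have hde := (h.of_perm (by grind) : IsQuintuple s d a b e c).pairIn_or hP hP'
  exact ⟨a, b, c, d, e, h, hab, hbc, PairIn.symm (by tauto), by tauto, hae.symm⟩

end IsQuintuple

end Separating

/-! ### Six points -/

section Six

theorem pairIn_compl_singleton_iff {X : Type*} [Fintype X] [DecidableEq X] {P : Finset X → Prop}
    {x y z : X} (hx : x ≠ z) (hy : y ≠ z) :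
    PairIn P {z}ᶜ x y ↔ P {x, y} ∨ P {x, y, z} := by
  constructor
  · rintro ⟨A, hA, h⟩
    simp only [Finset.mem_compl, Finset.mem_singleton] at h
    by_cases hz : z ∈ A
    · right
      convert hA
      ext w
      by_cases hw : w = z
      · simp [hw, hz]
      · simp [h w hw, hw]
    · left
      convert hA
      ext w
      by_cases hw : w = z
      · simp [hw, hz, hx.symm, hy.symm]
      · simp [h w hw]
  · rintro (h | h)
    · exact ⟨_, h, fun w _ => by simp⟩
    · refine ⟨_, h, fun w hw => ?_⟩
      simp only [Finset.mem_compl, Finset.mem_singleton] at hw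
      simp [hw]

/-- The conditions on the pairs `{i, i + 1}` (`a i`), the triples `{i, i + 1, p}` (`b i`) and the
pairs `{i, p}` (`c i`) that are parts of splits are contradictory. If all `a i` hold, no `c i`
holds, and exactly one of `b i` and `b (i + 2)` holds, which is impossible around an odd cycle.
If `a (i + 2)` fails, then `b (i + 1)`, `b (i + 2)` and `b (i + 3)` hold. -/
theorem false_of_cyclic_conditions (a b c : Fin 5 → Prop) (hab : ∀ i, a i ∨ b i)
    (hb : ∀ i, ¬ (b (i + 1) ∧ b (i + 2) ∧ b (i + 3)))
    (h1 : ∀ i, (a (i + 1) ∨ b (i + 3)) ∨ a (i + 2))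
    (h2 : ∀ i, (a (i + 3) ∨ b (i + 1)) ∨ a (i + 2))
    (h3 : ∀ i, ¬ ((a (i + 1) ∨ b (i + 3)) ∧ b (i + 2) ∧ (c (i + 1) ∨ b i)))
    (h4 : ∀ i, ¬ ((a (i + 3) ∨ b (i + 1)) ∧ b (i + 2) ∧ (c (i + 4) ∨ b (i + 4))))
    (h5 : ∀ i, (a (i + 1) ∨ b (i + 3)) ∨ b (i + 2))
    (h6 : ∀ i, (a (i + 3) ∨ b (i + 1)) ∨ b (i + 2))
    (h7 : ∀ i, ¬ ((a (i + 1) ∨ b (i + 3)) ∧ a (i + 2) ∧ c (i + 2)))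
    (h8 : ∀ i, b (i + 2) ∨ (c (i + 1) ∨ b i)) : False := by
  by_cases ha : ∀ i, a i
  · have hc : ∀ i, ¬ c (i + 2) := fun i h => h7 i ⟨Or.inl (ha _), ha _, h⟩
    have hxor : ∀ i, b (i + 2) ↔ ¬ b i := by
      intro i
      have hc' : ¬ c (i + 1) := by
        have := hc (i + 4)
        rwa [add_assoc] at this
      have h3' := h3 i
      have h8' := h8 i
      have ha' := ha (i + 1)
      tauto
    have e0 : b 2 ↔ ¬ b 0 := hxor 0
    have e1 : b 4 ↔ ¬ b 2 := hxor 2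
    have e2 : b 1 ↔ ¬ b 4 := hxor 4
    have e3 : b 3 ↔ ¬ b 1 := hxor 1
    have e4 : b 0 ↔ ¬ b 3 := hxor 3
    tauto
  · push Not at ha
    obtain ⟨j, hj⟩ := ha
    obtain ⟨i, rfl⟩ : ∃ i, i + 2 = j := ⟨j - 2, sub_add_cancel j 2⟩
    have k5 : (a (i + 2) ∨ b (i + 4)) ∨ b (i + 3) := by
      have := h5 (i + 1)
      rw [add_assoc, add_assoc, add_assoc] at this
      exact this
    have k6 : (a (i + 2) ∨ b i) ∨ b (i + 1) := by
      have := h6 (i + 4)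
      rw [add_assoc, add_assoc, add_assoc] at this
      simpa using this
    have := h1 i
    have := h2 i
    have := h3 i
    have := h4 i
    have := hab (i + 2)
    have := hb i
    tauto

/-- A separating family on `{0, ..., 5}` that restricts to the 5-cycle `0, 1, 2, 3, 4` off the
point `5` has three pairwise crossing members: up to complements, each member with at least two
points on both sides is one of `{i, i + 1}`, `{i, i + 1, 5}`, `{i, 5}` with `i` modulo 5, and the
graphs on the complements of the points `i` are 2-regular as well. -/
theorem false_of_pentagon {Q : Finset (Fin 6) → Prop} (hQ : IsSeparating Q)
    (hQ' : NoThreeCross Q)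
    (hpent : ∀ i : Fin 5, PairIn Q {5}ᶜ i.castSucc (i + 1).castSucc) : False := by
  let κ : Fin 5 → Fin 6 := Fin.castSucc
  have hcompl : ∀ A, Q A ↔ Q Aᶜ := fun A =>
    ⟨hQ.compl A, fun h => compl_compl A ▸ hQ.compl _ h⟩
  have hs : ∀ i : Fin 5, IsQuintuple ({5}ᶜ : Finset (Fin 6)) (κ i) (κ (i + 1)) (κ (i + 2))
      (κ (i + 3)) (κ (i + 4)) := fun i => ⟨by revert i; decide, by revert i; decide⟩
  have ht : ∀ i : Fin 5, IsQuintuple ({κ i}ᶜ : Finset (Fin 6)) (κ (i + 1)) (κ (i + 2))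
      (κ (i + 3)) (κ (i + 4)) 5 := fun i => ⟨by revert i; decide, by revert i; decide⟩
  -- the diagonals of the 5-cycle are no edges
  have hnon : ∀ i, ¬ Q {κ i, κ (i + 2)} ∧ ¬ Q {κ i, κ (i + 2), 5} := by
    intro i
    rw [← not_or, ← pairIn_compl_singleton_iff (by revert i; decide) (by revert i; decide)]
    intro h
    have h' := hpent (i + 1)
    rw [add_assoc] at h'
    exact (hs i).not_triangle hQ' ⟨hpent i, h, h'⟩
  let a : Fin 5 → Prop := fun i => Q {κ i, κ (i + 1)}
  let b : Fin 5 → Prop := fun i => Q {κ i, κ (i + 1), 5}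
  let c : Fin 5 → Prop := fun i => Q {κ i, 5}
  -- the edges of the graph on the complement of `κ i`
  have e12 : ∀ i, PairIn Q {κ i}ᶜ (κ (i + 1)) (κ (i + 2)) ↔ a (i + 1) ∨ b (i + 3) := by
    intro i
    rw [pairIn_compl_singleton_iff (by revert i; decide) (by revert i; decide),
      hcompl {κ (i + 1), κ (i + 2), κ i}]
    refine or_congr (iff_of_eq (congrArg Q ?_)) (iff_of_eq (congrArg Q ?_)) <;>
      revert i <;> decide
  have e34 : ∀ i, PairIn Q {κ i}ᶜ (κ (i + 3)) (κ (i + 4)) ↔ a (i + 3) ∨ b (i + 1) := by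
    intro i
    rw [pairIn_compl_singleton_iff (by revert i; decide) (by revert i; decide),
      hcompl {κ (i + 3), κ (i + 4), κ i}]
    refine or_congr (iff_of_eq (congrArg Q ?_)) (iff_of_eq (congrArg Q ?_)) <;>
      revert i <;> decide
  have e23 : ∀ i, PairIn Q {κ i}ᶜ (κ (i + 2)) (κ (i + 3)) ↔ a (i + 2) := by
    intro i
    rw [pairIn_compl_singleton_iff (by revert i; decide) (by revert i; decide),
      hcompl {κ (i + 2), κ (i + 3), κ i},
      show ({κ (i + 2), κ (i + 3), κ i} : Finset (Fin 6))ᶜ = {κ (i + 4), κ (i + 4 + 2), 5} by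
        revert i; decide, or_iff_left (hnon (i + 4)).2]
    refine iff_of_eq (congrArg Q ?_)
    revert i; decide
  have e14 : ∀ i, PairIn Q {κ i}ᶜ (κ (i + 1)) (κ (i + 4)) ↔ b (i + 2) := by
    intro i
    rw [pairIn_compl_singleton_iff (by revert i; decide) (by revert i; decide),
      hcompl {κ (i + 1), κ (i + 4), κ i},
      show ({κ (i + 1), κ (i + 4)} : Finset (Fin 6)) = {κ (i + 4), κ (i + 4 + 2)} by
        revert i; decide, or_iff_right (hnon (i + 4)).1]
    refine iff_of_eq (congrArg Q ?_)
    revert i; decide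
  have e13 : ∀ i, ¬ PairIn Q {κ i}ᶜ (κ (i + 1)) (κ (i + 3)) := by
    intro i
    rw [pairIn_compl_singleton_iff (by revert i; decide) (by revert i; decide),
      hcompl {κ (i + 1), κ (i + 3), κ i},
      show ({κ (i + 1), κ (i + 3)} : Finset (Fin 6)) = {κ (i + 1), κ (i + 1 + 2)} by
        revert i; decide,
      show ({κ (i + 1), κ (i + 3), κ i} : Finset (Fin 6))ᶜ = {κ (i + 2), κ (i + 2 + 2), 5} by
        revert i; decide]
    exact not_or.2 ⟨(hnon (i + 1)).1, (hnon (i + 2)).2⟩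
  have e24 : ∀ i, ¬ PairIn Q {κ i}ᶜ (κ (i + 2)) (κ (i + 4)) := by
    intro i
    rw [pairIn_compl_singleton_iff (by revert i; decide) (by revert i; decide),
      hcompl {κ (i + 2), κ (i + 4), κ i},
      show ({κ (i + 2), κ (i + 4)} : Finset (Fin 6)) = {κ (i + 2), κ (i + 2 + 2)} by
        revert i; decide,
      show ({κ (i + 2), κ (i + 4), κ i} : Finset (Fin 6))ᶜ = {κ (i + 1), κ (i + 1 + 2), 5} by
        revert i; decide]
    exact not_or.2 ⟨(hnon (i + 2)).1, (hnon (i + 1)).2⟩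
  have e1p : ∀ i, PairIn Q {κ i}ᶜ (κ (i + 1)) 5 ↔ c (i + 1) ∨ b i := by
    intro i
    rw [pairIn_compl_singleton_iff (by revert i; decide) (by revert i; decide)]
    refine or_congr Iff.rfl (iff_of_eq (congrArg Q ?_))
    revert i; decide
  have e4p : ∀ i, PairIn Q {κ i}ᶜ (κ (i + 4)) 5 ↔ c (i + 4) ∨ b (i + 4) := by
    intro i
    rw [pairIn_compl_singleton_iff (by revert i; decide) (by revert i; decide)]
    refine or_congr Iff.rfl (iff_of_eq (congrArg Q ?_))
    revert i; decide
  have e2p : ∀ i, c (i + 2) → PairIn Q {κ i}ᶜ (κ (i + 2)) 5 := by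
    intro i
    rw [pairIn_compl_singleton_iff (by revert i; decide) (by revert i; decide)]
    exact Or.inl
  have symm : ∀ i x y, PairIn Q {κ i}ᶜ x y ↔ PairIn Q {κ i}ᶜ y x := fun i x y =>
    ⟨PairIn.symm, PairIn.symm⟩
  have hbb : ∀ i j : Fin 5, i ≠ j →
      Cross ({κ i, κ (i + 1), 5} : Finset (Fin 6)) {κ j, κ (j + 1), 5} := by decide
  refine false_of_cyclic_conditions a b c (fun i => ?_) (fun i ⟨h1, h2, h3⟩ => ?_) ?_ ?_ ?_ ?_ ?_
    ?_ ?_ ?_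
  · exact (pairIn_compl_singleton_iff (by revert i; decide) (by revert i; decide)).1 (hpent i)
  · exact hQ' _ _ _ h1 h2 h3 (hbb _ _ (by simp)) (hbb _ _ (by simp)) (hbb _ _ (by simp))
  all_goals intro i
  · have := ((ht i).of_perm (by clear * -; grind) : IsQuintuple _ (κ (i + 2)) (κ (i + 1)) (κ (i + 3))
      (κ (i + 4)) 5).pairIn_or hQ hQ'
    rw [symm, e12, e23] at this
    have := e24 i
    tauto
  · have := ((ht i).of_perm (by clear * -; grind) : IsQuintuple _ (κ (i + 3)) (κ (i + 1)) (κ (i + 2))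
      (κ (i + 4)) 5).pairIn_or hQ hQ'
    rw [e34, symm i (κ (i + 3)), symm i (κ (i + 3)), e23] at this
    have := e13 i
    tauto
  · have := ((ht i).of_perm (by clear * -; grind) : IsQuintuple _ (κ (i + 1)) (κ (i + 2)) (κ (i + 4)) 5
      (κ (i + 3))).not_star hQ'
    rwa [e12, e14, e1p] at this
  · have := ((ht i).of_perm (by clear * -; grind) : IsQuintuple _ (κ (i + 4)) (κ (i + 3)) (κ (i + 1)) 5
      (κ (i + 2))).not_star hQ'
    rwa [symm, e34, symm i (κ (i + 4)), e14, e4p] at this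
  · have := ((ht i).of_perm (by clear * -; grind) : IsQuintuple _ (κ (i + 1)) (κ (i + 2)) (κ (i + 3))
      (κ (i + 4)) 5).pairIn_or hQ hQ'
    rw [e12, e14] at this
    have := e13 i
    tauto
  · have := ((ht i).of_perm (by clear * -; grind) : IsQuintuple _ (κ (i + 4)) (κ (i + 3)) (κ (i + 2))
      (κ (i + 1)) 5).pairIn_or hQ hQ'
    rw [symm, e34, symm i (κ (i + 4)), symm i (κ (i + 4)), e14] at this
    have := e24 i
    tauto
  · rintro ⟨h1, h2, h3⟩
    exact ((ht i).of_perm (by clear * -; grind) : IsQuintuple _ (κ (i + 2)) (κ (i + 1)) (κ (i + 3)) 5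
      (κ (i + 4))).not_star hQ' ⟨((e12 i).2 h1).symm, (e23 i).2 h2, e2p i h3⟩
  · have := ((ht i).of_perm (by clear * -; grind) : IsQuintuple _ (κ (i + 1)) (κ (i + 3)) (κ (i + 4)) 5
      (κ (i + 2))).pairIn_or hQ hQ'
    rw [e14, e1p] at this
    have := e13 i
    tauto

/-- A separating family on at least six points has three pairwise crossing members. -/
theorem IsSeparating.exists_three_cross {X : Type*} [Fintype X] [DecidableEq X]
    {P : Finset X → Prop} (hP : IsSeparating P) (hX : 6 ≤ Fintype.card X) :
    ∃ A B C, P A ∧ P B ∧ P C ∧ Cross A B ∧ Cross A C ∧ Cross B C := by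
  by_contra hcon
  have hP' : NoThreeCross P := fun A B C hA hB hC h1 h2 h3 =>
    hcon ⟨A, B, C, hA, hB, hC, h1, h2, h3⟩
  obtain ⟨s, -, hs⟩ := Finset.exists_subset_card_eq
    (s := (Finset.univ : Finset X)) (n := 5) (by rw [Finset.card_univ]; omega)
  obtain ⟨p, hp⟩ : ∃ p, p ∉ s := by
    by_contra! h
    rw [(Finset.eq_univ_iff_forall.2 h), Finset.card_univ] at hs
    omega
  obtain ⟨v0, v1, v2, v3, v4, hq, h01, h12, h23, h34, h40⟩ :=
    IsQuintuple.exists_pentagon hs hP hP'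
  have hps : ∀ x ∈ s, x ≠ p := fun x hx h => hp (h ▸ hx)
  rw [hq.forall_mem] at hps
  have hinj : Function.Injective ![v0, v1, v2, v3, v4, p] := by
    rw [← List.nodup_ofFn]
    have := hq.nodup
    simp only [List.nodup_cons, List.mem_cons, List.not_mem_nil, or_false, not_or] at this
    simp [List.ofFn_succ]
    tauto
  let f : Fin 6 ↪ X := ⟨_, hinj⟩
  refine false_of_pentagon (hP.comap f) (hP'.comap f) fun i => ?_
  have key : ∀ i j : Fin 6, PairIn P s (f i) (f j) → PairIn (preimageFamily f P) {5}ᶜ i j := by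
    rintro i j ⟨A, hA, h⟩
    refine ⟨Finset.univ.filter fun y => f y ∈ A, ⟨A, hA, by simp⟩, fun x hx => ?_⟩
    have hxs : f x ∈ s := by
      rw [hq.mem_iff]
      fin_cases x <;> simp [f] at hx ⊢
    simp [h _ hxs]
  fin_cases i
  · exact key 0 1 h01
  · exact key 1 2 h12
  · exact key 2 3 h23
  · exact key 3 4 h34
  · exact key 4 0 h40

end Six

/-! ### Lower bounds for the dimension -/

namespace SplitSystem

variable {X : Type*} [Fintype X] [DecidableEq X] {𝒮 : SplitSystem X}

theorem IsInjective.isSeparating (h : 𝒮.IsInjective) : IsSeparating 𝒮.IsSide :=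
  ⟨fun _ hA => hA.compl, isInjective_iff.1 h⟩

theorem one_le_dim [Nonempty X] (𝒮 : SplitSystem X) : 1 ≤ 𝒮.dim := by
  obtain ⟨x⟩ := ‹Nonempty X›
  exact le_dim_iff.2 ⟨fun _ => {x}, fun _ => 𝒮.trivial_mem x,
    fun i j h => absurd (Subsingleton.elim i j) h⟩

theorem IsInjective.two_le_dim (h : 𝒮.IsInjective) (hX : 4 ≤ Fintype.card X) : 2 ≤ 𝒮.dim := by
  have : Nonempty X := Fintype.card_pos_iff.1 (by omega)
  obtain ⟨A, B, hA, hB, hAB⟩ := h.isSeparating.exists_cross hX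
  refine le_dim_iff.2 ⟨![A, B], ?_, ?_⟩
  · simp [Fin.forall_fin_two, hA, hB]
  · simp [Fin.forall_fin_two, hAB, hAB.symm]

theorem IsInjective.three_le_dim (h : 𝒮.IsInjective) (hX : 6 ≤ Fintype.card X) : 3 ≤ 𝒮.dim := by
  have : Nonempty X := Fintype.card_pos_iff.1 (by omega)
  obtain ⟨A, B, C, hA, hB, hC, hAB, hAC, hBC⟩ := h.isSeparating.exists_three_cross hX
  refine le_dim_iff.2 ⟨![A, B, C], ?_, ?_⟩
  · simp [Fin.forall_fin_succ, hA, hB, hC]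
  · simp [Fin.forall_fin_succ, hAB, hAB.symm, hAC, hAC.symm, hBC, hBC.symm]

end SplitSystem

/-! ### Split systems given by families of parts -/

namespace SplitSystem

section OfSides

variable {X : Type*} [Fintype X] [DecidableEq X]

/-- The split system formed by the trivial splits and the splits `A | X - A` for `A` in a family
of nonempty proper subsets. -/
def ofSides (hX : 2 ≤ Fintype.card X) (𝒜 : Finset (Finset X))
    (h𝒜 : ∀ A ∈ 𝒜, A.Nonempty ∧ Aᶜ.Nonempty) : SplitSystem X where
  splits := (𝒜 ∪ Finset.univ.image fun x => {x}).image fun A => {A, Aᶜ}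
  isSplit := by
    intro S hS
    obtain ⟨A, hA, rfl⟩ := Finset.mem_image.1 hS
    rcases Finset.mem_union.1 hA with hA | hA
    · exact isSplit_pair_compl (h𝒜 A hA).1 (h𝒜 A hA).2
    · obtain ⟨x, -, rfl⟩ := Finset.mem_image.1 hA
      refine isSplit_pair_compl (Finset.singleton_nonempty x) (Finset.card_pos.1 ?_)
      rw [Finset.card_compl, Finset.card_singleton]
      omega
  trivial_mem x := Finset.mem_image_of_mem _ (Finset.mem_union_right _
    (Finset.mem_image_of_mem _ (Finset.mem_univ x)))

variable {hX : 2 ≤ Fintype.card X} {𝒜 : Finset (Finset X)}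
  {h𝒜 : ∀ A ∈ 𝒜, A.Nonempty ∧ Aᶜ.Nonempty}

theorem isSide_ofSides {A : Finset X} (hA : A ∈ 𝒜) : (ofSides hX 𝒜 h𝒜).IsSide A :=
  Finset.mem_image_of_mem (fun A => ({A, Aᶜ} : Finset (Finset X))) (Finset.mem_union_left _ hA)

/-- A part that crosses another set does not come from a trivial split. -/
theorem exists_of_isSide_ofSides {A C : Finset X} (hA : (ofSides hX 𝒜 h𝒜).IsSide A)
    (hC : Cross A C) : ∃ B ∈ 𝒜, A = B ∨ A = Bᶜ := by
  obtain ⟨B, hB, hBA⟩ := Finset.mem_image.1 hA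
  have hAB : A = B ∨ A = Bᶜ := by
    have : A ∈ ({B, Bᶜ} : Finset (Finset X)) := by
      rw [hBA]
      exact Finset.mem_insert_self _ _
    simpa using this
  rcases Finset.mem_union.1 hB with hB | hB
  · exact ⟨B, hB, hAB⟩
  · obtain ⟨x, -, rfl⟩ := Finset.mem_image.1 hB
    rcases hAB with rfl | rfl
    · exact absurd hC (not_cross_singleton x C)
    · exact absurd (compl_compl ({x} : Finset X) ▸ hC.compl_left) (not_cross_singleton x C)

theorem exists_cross_of_le_dim_ofSides [Nonempty X] {k : ℕ} (hk : 2 ≤ k)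
    (h : k ≤ (ofSides hX 𝒜 h𝒜).dim) :
    ∃ B : Fin k → Finset X, (∀ i, B i ∈ 𝒜) ∧ ∀ i j, i ≠ j → Cross (B i) (B j) := by
  obtain ⟨A, hA, hcross⟩ := le_dim_iff.1 h
  have : ∀ i, ∃ B ∈ 𝒜, A i = B ∨ A i = Bᶜ := by
    intro i
    have : Nontrivial (Fin k) := Fin.nontrivial_iff_two_le.2 hk
    obtain ⟨j, hj⟩ := exists_ne i
    exact exists_of_isSide_ofSides (hA i) (hcross i j hj.symm)
  choose B hB hAB using this
  have hleft : ∀ i C, Cross (A i) C → Cross (B i) C := by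
    intro i C h
    rcases hAB i with hi | hi
    · rwa [hi] at h
    · rw [hi] at h
      have := h.compl_left
      rwa [compl_compl] at this
  exact ⟨B, hB, fun i j hij => hleft i _ (hleft j _ (hcross i j hij).symm).symm⟩

theorem isInjective_ofSides (h : ∀ Y Z : Finset X, Y.card = 3 → Z.card = 3 →
    (∀ A ∈ 𝒜, Maj A Y ↔ Maj A Z) → Y = Z) : (ofSides hX 𝒜 h𝒜).IsInjective := by
  rw [isInjective_iff]
  intro Y Z hY hZ hne
  have : ∃ A ∈ 𝒜, ¬ (Maj A Y ↔ Maj A Z) := by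
    by_contra! hc
    exact hne (h Y Z hY hZ hc)
  obtain ⟨A, hA, hsep⟩ := this
  have hside := isSide_ofSides (hX := hX) (h𝒜 := h𝒜) hA
  by_cases hAY : Maj A Y
  · exact ⟨A, hside, hAY, by tauto⟩
  · exact ⟨Aᶜ, hside.compl, (maj_compl hY).2 hAY, by rw [maj_compl hZ]; tauto⟩

end OfSides

end SplitSystem

theorem exists_lt_lt_of_card_eq_three {α : Type*} [LinearOrder α] {Y : Finset α}
    (hY : Y.card = 3) : ∃ x y z, x < y ∧ y < z ∧ Y = {x, y, z} := by
  refine ⟨Y.orderEmbOfFin hY 0, Y.orderEmbOfFin hY 1, Y.orderEmbOfFin hY 2, by simp, by simp, ?_⟩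
  ext w
  have hw : w ∈ Y ↔ ∃ i, Y.orderEmbOfFin hY i = w := by
    rw [← Finset.mem_coe, ← Finset.range_orderEmbOfFin Y hY, Set.mem_range]
  simp only [hw, Fin.exists_fin_succ, Finset.mem_insert, Finset.mem_singleton, eq_comm (a := w)]
  simp

/-! ### The circular split system -/

section Intervals

variable {n : ℕ}

/-- The intervals `{i, ..., j - 1}` of `{0, ..., n - 1}`. None of them contains `n - 1`; they
represent all splits into two arcs of the `n` points arranged in a circle. -/
def intervals (n : ℕ) : Finset (Finset (Fin n)) :=
  ((Finset.univ : Finset (Fin n × Fin n)).filter fun p => p.1 < p.2).image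
    fun p => Finset.Ico p.1 p.2

theorem mem_intervals {A : Finset (Fin n)} :
    A ∈ intervals n ↔ ∃ i j : Fin n, i < j ∧ A = Finset.Ico i j := by
  simp [intervals, eq_comm]

theorem nonempty_of_mem_intervals {A : Finset (Fin n)} (hA : A ∈ intervals n) :
    A.Nonempty ∧ Aᶜ.Nonempty := by
  obtain ⟨i, j, hij, rfl⟩ := mem_intervals.1 hA
  exact ⟨⟨i, by simpa using hij⟩, ⟨j, by simp⟩⟩

theorem lt_of_cross_Ico {i j k l : Fin n} (h : Cross (Finset.Ico i j) (Finset.Ico k l)) :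
    (i < k ∧ k < j ∧ j < l) ∨ (k < i ∧ i < l ∧ l < j) := by
  obtain ⟨⟨x, hx⟩, ⟨y, hy⟩, ⟨z, hz⟩, -⟩ := h
  simp only [Finset.mem_inter, Finset.mem_compl, Finset.mem_Ico] at hx hy hz
  omega

/-- The end points of pairwise crossing intervals are distinct. -/
theorem two_mul_le_of_cross_intervals {k : ℕ} {B : Fin k → Finset (Fin n)}
    (hB : ∀ i, B i ∈ intervals n) (hcross : ∀ i j, i ≠ j → Cross (B i) (B j)) : 2 * k ≤ n := by
  choose l r hlr hBlr using fun i => mem_intervals.1 (hB i)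
  have key : ∀ i j, i ≠ j → (l i < l j ∧ l j < r i ∧ r i < r j) ∨
      (l j < l i ∧ l i < r j ∧ r j < r i) := fun i j hij =>
    lt_of_cross_Ico (hBlr i ▸ hBlr j ▸ hcross i j hij)
  have hinj : Function.Injective (Sum.elim l r) := by
    rintro (i | i) (j | j) h
    all_goals
      simp only [Sum.elim_inl, Sum.elim_inr] at h
      by_cases hij : i = j
    · rw [hij]
    · have := key i j hij
      omega
    · have := hlr i
      subst hij
      omega
    · have := key i j hij
      have := hlr i
      omega
    · have := hlr i
      subst hij
      omega
    · have := key i j hij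
      have := hlr i
      omega
    · rw [hij]
    · have := key i j hij
      omega
  have := Fintype.card_le_of_injective _ hinj
  simp only [Fintype.card_sum, Fintype.card_fin] at this
  omega

/-- Comparing the majorities for three intervals that end at points of `{y₁, y₂, y₃}`. -/
theorem le_of_forall_maj_Ico {y₁ y₂ y₃ z₁ z₂ z₃ : Fin n} (hy : y₁ < y₂) (hy' : y₂ < y₃)
    (hz : z₁ < z₂) (hz' : z₂ < z₃)
    (h : ∀ i j : Fin n, i < j → (Maj (Finset.Ico i j) {y₁, y₂, y₃} ↔
      Maj (Finset.Ico i j) {z₁, z₂, z₃})) : y₂ = z₂ ∧ y₁ ≤ z₁ ∧ y₃ ≤ z₃ := by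
  simp only [maj_triple hy.ne (hy.trans hy').ne hy'.ne, maj_triple hz.ne (hz.trans hz').ne hz'.ne,
    Finset.mem_Ico] at h
  have h1 := (h y₁ ⟨y₂ + 1, by omega⟩ (Fin.lt_def.2 (by simp; omega))).1
    (Or.inl ⟨⟨le_rfl, Fin.lt_def.2 (by simp; omega)⟩, hy.le, Fin.lt_def.2 (by simp)⟩)
  have h2 : ¬ z₂ < y₂ := by
    intro hlt
    have := (h ⟨0, by omega⟩ y₂ (Fin.lt_def.2 (by simp; omega))).2
      (Or.inl ⟨⟨Fin.le_def.2 (by simp), by omega⟩, Fin.le_def.2 (by simp), hlt⟩)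
    omega
  simp only [Fin.lt_def, Fin.le_def] at h1
  have h12 : y₂ = z₂ ∧ y₁ ≤ z₁ := by omega
  obtain ⟨rfl, hle⟩ := h12
  refine ⟨rfl, hle, ?_⟩
  by_contra hlt
  have := (h y₂ y₃ hy').2 (Or.inr (Or.inl ⟨⟨le_rfl, hy'⟩, hz'.le, by omega⟩))
  omega

theorem eq_of_forall_maj_intervals {Y Z : Finset (Fin n)} (hY : Y.card = 3) (hZ : Z.card = 3)
    (h : ∀ A ∈ intervals n, Maj A Y ↔ Maj A Z) : Y = Z := by
  obtain ⟨y₁, y₂, y₃, hy, hy', rfl⟩ := exists_lt_lt_of_card_eq_three hY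
  obtain ⟨z₁, z₂, z₃, hz, hz', rfl⟩ := exists_lt_lt_of_card_eq_three hZ
  have h' : ∀ i j : Fin n, i < j → (Maj (Finset.Ico i j) {y₁, y₂, y₃} ↔
      Maj (Finset.Ico i j) {z₁, z₂, z₃}) := fun i j hij => h _ (mem_intervals.2 ⟨i, j, hij, rfl⟩)
  obtain ⟨e2, e1, e3⟩ := le_of_forall_maj_Ico hy hy' hz hz' h'
  obtain ⟨-, f1, f3⟩ := le_of_forall_maj_Ico hz hz' hy hy' fun i j hij => (h' i j hij).symm
  rw [e2, le_antisymm e1 f1, le_antisymm e3 f3]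

/-- The splits of `n` points on a circle into two arcs. -/
def SplitSystem.circular (hn : 2 ≤ n) : SplitSystem (Fin n) :=
  .ofSides (by simpa) (intervals n) fun _ => nonempty_of_mem_intervals

theorem SplitSystem.isInjective_circular (hn : 2 ≤ n) : (circular hn).IsInjective :=
  isInjective_ofSides fun _ _ => eq_of_forall_maj_intervals

theorem SplitSystem.dim_circular_le (hn : 2 ≤ n) : (circular hn).dim ≤ n / 2 := by
  have : Nonempty (Fin n) := ⟨⟨0, by omega⟩⟩
  by_cases hd : 2 ≤ (circular hn).dim
  · obtain ⟨B, hB, hcross⟩ := exists_cross_of_le_dim_ofSides hd le_rfl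
    have := two_mul_le_of_cross_intervals hB hcross
    omega
  · omega

end Intervals

/-! ### A split system on eight points -/

section Octet

/-- Indicator functions of 13 subsets of an 8-set: `{2,3}`, `{6,7}`, `{0,4}`, `{1,4}`, `{0,5}`,
`{1,5}`, `{2,6}`, `{3,6}`, `{3,7}`, `{2,7}`, `{0,1,2,3}`, `{1,2,5,6}`, `{0,3,5,6}`. They are stored
in binary notation, so that the finite checks below are fast. -/
def octetMem (i : Fin 13) (x : Fin 8) : Bool :=
  (![12, 192, 17, 18, 33, 34, 68, 72, 136, 132, 15, 102, 105] i : ℕ).testBit x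

/-- The 13 subsets with indicator functions `octetMem`. -/
def octetSide (i : Fin 13) : Finset (Fin 8) := Finset.univ.filter fun x => octetMem i x

/-- A partition of the 13 subsets into three classes without crossing members. -/
def octetColor : Fin 13 → Fin 3 := ![0, 0, 1, 2, 2, 1, 1, 2, 1, 2, 0, 1, 2]

theorem mem_octetSide {i : Fin 13} {x : Fin 8} : x ∈ octetSide i ↔ octetMem i x := by
  simp [octetSide]

theorem octetSide_nonempty (i : Fin 13) : (octetSide i).Nonempty ∧ (octetSide i)ᶜ.Nonempty := by
  have : ∀ i, (∃ x, octetMem i x) ∧ ∃ x, ¬ octetMem i x := by decide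
  obtain ⟨⟨x, hx⟩, ⟨y, hy⟩⟩ := this i
  exact ⟨⟨x, mem_octetSide.2 hx⟩, ⟨y, Finset.mem_compl.2 fun h => hy (mem_octetSide.1 h)⟩⟩

theorem octetColor_ne_of_cross {i j : Fin 13} (h : Cross (octetSide i) (octetSide j)) :
    octetColor i ≠ octetColor j := by
  have key : ∀ i j, octetColor i = octetColor j →
      (∀ x, ¬ (octetMem i x ∧ octetMem j x)) ∨ (∀ x, ¬ (octetMem i x ∧ ¬ octetMem j x)) ∨
      (∀ x, ¬ (¬ octetMem i x ∧ octetMem j x)) := by decide +kernel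
  intro hc
  obtain ⟨⟨x, hx⟩, ⟨y, hy⟩, ⟨z, hz⟩, -⟩ := h
  simp only [Finset.mem_inter, Finset.mem_compl, mem_octetSide] at hx hy hz
  rcases key i j hc with h | h | h
  · exact h x hx
  · exact h y hy
  · exact h z hz

/-- For each of the 13 subsets, whether it contains the majority of `{x, y, z}`. -/
def octetMaj (t : Fin 8 × Fin 8 × Fin 8) : List Bool :=
  (List.finRange 13).map fun i => (octetMem i t.1 && octetMem i t.2.1) ||
    (octetMem i t.2.1 && octetMem i t.2.2) || (octetMem i t.1 && octetMem i t.2.2)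

/-- The increasing triples of elements of the 8-set. -/
def octetTriples : List (Fin 8 × Fin 8 × Fin 8) :=
  (List.finRange 8 ×ˢ List.finRange 8 ×ˢ List.finRange 8).filter
    fun t => t.1 < t.2.1 ∧ t.2.1 < t.2.2

theorem mem_octetTriples {x y z : Fin 8} (hxy : x < y) (hyz : y < z) :
    (x, y, z) ∈ octetTriples := by
  simp [octetTriples, hxy, hyz]

theorem octetMaj_eq_iff {x y z x' y' z' : Fin 8} (hxy : x < y) (hyz : y < z) (hxy' : x' < y')
    (hyz' : y' < z') : octetMaj (x, y, z) = octetMaj (x', y', z') ↔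
      ∀ i, Maj (octetSide i) {x, y, z} ↔ Maj (octetSide i) {x', y', z'} := by
  simp only [octetMaj, List.map_inj_left, List.mem_finRange, forall_const,
    maj_triple hxy.ne (hxy.trans hyz).ne hyz.ne, maj_triple hxy'.ne (hxy'.trans hyz').ne hyz'.ne,
    mem_octetSide]
  refine forall_congr' fun i => ?_
  rw [Bool.eq_iff_iff]
  simp only [Bool.or_eq_true, Bool.and_eq_true, or_assoc]

theorem eq_of_forall_maj_octetSide {Y Z : Finset (Fin 8)} (hY : Y.card = 3) (hZ : Z.card = 3)
    (h : ∀ i, Maj (octetSide i) Y ↔ Maj (octetSide i) Z) : Y = Z := by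
  obtain ⟨y₁, y₂, y₃, hy, hy', rfl⟩ := exists_lt_lt_of_card_eq_three hY
  obtain ⟨z₁, z₂, z₃, hz, hz', rfl⟩ := exists_lt_lt_of_card_eq_three hZ
  have hnodup : (octetTriples.map octetMaj).Nodup := by decide +kernel
  have := List.inj_on_of_nodup_map hnodup (mem_octetTriples hy hy') (mem_octetTriples hz hz')
    ((octetMaj_eq_iff hy hy' hz hz').2 h)
  simp only [Prod.mk.injEq] at this
  rw [this.1, this.2.1, this.2.2]

/-- A split system of dimension 3 on eight points. -/
def SplitSystem.octet : SplitSystem (Fin 8) :=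
  .ofSides (by simp) (Finset.univ.image octetSide) (by
    intro A hA
    obtain ⟨i, -, rfl⟩ := Finset.mem_image.1 hA
    exact octetSide_nonempty i)

theorem SplitSystem.isInjective_octet : octet.IsInjective :=
  isInjective_ofSides fun _ _ hY hZ h => eq_of_forall_maj_octetSide hY hZ fun i =>
    h _ (Finset.mem_image_of_mem _ (Finset.mem_univ i))

theorem SplitSystem.dim_octet_le : octet.dim ≤ 3 := by
  by_contra! hd
  obtain ⟨B, hB, hcross⟩ := exists_cross_of_le_dim_ofSides (by norm_num) hd
  choose s hs using fun i => Finset.mem_image.1 (hB i)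
  have hinj : Function.Injective fun i => octetColor (s i) := by
    intro i j hij
    by_contra hne
    have := hcross i j hne
    rw [← (hs i).2, ← (hs j).2] at this
    exact octetColor_ne_of_cross this hij
  simpa using Fintype.card_le_of_injective _ hinj

end Octet

/-! ### The injective dimension -/

theorem injDim_le {n : ℕ} {𝒮 : SplitSystem (Fin n)} (h : 𝒮.IsInjective) : injDim n ≤ 𝒮.dim :=
  Nat.sInf_le ⟨𝒮, h, rfl⟩

theorem injDim_le_half {n : ℕ} (hn : 2 ≤ n) : injDim n ≤ n / 2 :=
  (injDim_le (SplitSystem.isInjective_circular hn)).trans (SplitSystem.dim_circular_le hn)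

theorem le_injDim {n d : ℕ} (hn : 2 ≤ n)
    (h : ∀ 𝒮 : SplitSystem (Fin n), 𝒮.IsInjective → d ≤ 𝒮.dim) : d ≤ injDim n := by
  -- the infimum is taken over a nonempty set, hence attained
  obtain ⟨𝒮, h𝒮, hd⟩ := Nat.sInf_mem (s := {d : ℕ | ∃ 𝒮 : SplitSystem (Fin n),
    𝒮.IsInjective ∧ 𝒮.dim = d}) ⟨_, _, SplitSystem.isInjective_circular hn, rfl⟩
  exact (h 𝒮 h𝒮).trans hd.le

theorem theorem3 :
    (∀ n : ℕ, 4 ≤ n → injDim n ≤ n / 2) ∧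
    injDim 3 = 1 ∧
    injDim 4 = 2 ∧ injDim 5 = 2 ∧
    injDim 6 = 3 ∧ injDim 7 = 3 ∧ injDim 8 = 3 ∧
    (∀ n : ℕ, 9 ≤ n → 3 ≤ injDim n) := by
  have h2 : ∀ n, 4 ≤ n → 2 ≤ injDim n := fun n hn =>
    le_injDim (by omega) fun 𝒮 h => h.two_le_dim (by simpa)
  have h3 : ∀ n, 6 ≤ n → 3 ≤ injDim n := fun n hn =>
    le_injDim (by omega) fun 𝒮 h => h.three_le_dim (by simpa)
  exact ⟨fun n hn => injDim_le_half (by omega),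
    le_antisymm (injDim_le_half (by norm_num)) (le_injDim (by norm_num) fun 𝒮 _ => 𝒮.one_le_dim),
    le_antisymm (injDim_le_half (by norm_num)) (h2 4 (by norm_num)),
    le_antisymm (injDim_le_half (by norm_num)) (h2 5 (by norm_num)),
    le_antisymm (injDim_le_half (by norm_num)) (h3 6 (by norm_num)),
    le_antisymm (injDim_le_half (by norm_num)) (h3 7 (by norm_num)),
    le_antisymm ((injDim_le SplitSystem.isInjective_octet).trans SplitSystem.dim_octet_le)
      (h3 8 (by norm_num)),
    fun n hn => h3 n (by omega)⟩
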